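/- Let $d\ge1$, let $n\ge1$, and let $l\ge 2$ be a divisor of $n$. Let $\Lambda=\{1,\dots,n\}^d$ with periodic boundary conditions, $N=n^d$, $B(i)=\{j\in\Lambda: |i-j|\le 1\}$. Every site carries a copy of one Hilbert space, of finite or infinite dimension. Let $$H=\sum_{i\in\Lambda}H_i+\sum_{i\in\Lambda}H_{B(i)},$$ where $H_i$ (respectively $H_{B(i)}$) is the translate by $i$ of one closed, possibly unbounded, operator acting on a single site (respectively on a site and its nearest neighbours), and $H$ denotes a self-adjoint operator extending this sum. Assume that $H$ has ground state energy $0$ and that $Z_T=\mathrm{tr}\,e^{-H/T}<\infty$ for all $T>0$; let $D$ be the (finite) ground state degeneracy, $\rho_T=e^{-H/T}/Z_T$, $u(T)=\mathrm{tr}(H\rho_T)/N$ and $c(T)=u'(T)$. All logarithms are natural and $S(\rho)=-\mathrm{tr}(\rho\log\rho)$. Let $\rho=|\psi\rangle\langle\psi|$ be a translation-invariant pure state, with $\psi$ in the domain of all the $H_i$ and $H_{B(i)}$, such that $\langle\psi,H\psi\rangle\le C n^d/l$ with $C\ge 1$. Let $R\subset\Lambda$ be a cube of edge length $l$ and $\partial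 R$ its outermost layer of sites. The coupling strength $h$ is one of the following two numbers. * If $H_{B(i)}$ is bounded, $h=\|H_{B(i)}\|$. * For possibly unbounded $H_{B(i)}$, suppose that for each $i\in\partial R$ one has $H_{B(i)}=\sum_{k=1}^{K} h_A^{(k)}\otimes h_B^{(k)}$ on the natural domain of the right-hand side, with closed operators $h_A^{(k)}$ acting on $A=B(i)\cap R$ and $h_B^{(k)}$ acting on at most one site of $B=B(i)\setminus R$ (as is the case for sums of couplings of pairs of nearest neighbours), and that $\psi$ is in the domains of all $h_A^{(k)}$, $h_B^{(k)}$ and $h_A^{(k)}h_B^{(k)}$. Then $h=\max_{i\in\partial R}\bigl|\sum_{k}\mathrm{Cov}_\rho(h_A^{(k)\dagger},h_B^{(k)})\bigr|$, where $\mathrm{Cov}_\rho(X^\dagger,Y)=\langle (X-\langle X\rangle_\rho)(Y-\langle Y\rangle_\rho)\rangle_\rho$. Let $T_c>0$ satisfy $u(T_c)=(C+4dh)/l$, and let $\gamma,k,\Delta>0$. Then there is a constant $C_0$ depending only on $C,\gamma,\Delta,k,h,d$ such that: 1. if $c(T)\le k(\Delta/T)^\gamma e^{-\Delta/T}$ for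 all $0<T\le T_c$, then $$S(\rho_R)\le \Bigl(\frac{l}{n}\Bigr)^d\log D+C_0\,l^{d-1}\log l ;$$ 2. if $c(T)\le k(T/\Delta)^\gamma$ for all $0<T\le T_c$, then $$S(\rho_R)\le \Bigl(\frac{l}{n}\Bigr)^d\log D+C_0\,l^{d-1+\frac1{\gamma+1}} .$$ In particular, for a unique ground state ($D=1$) these are an area law with a logarithmic correction and a subvolume law. -/

import Mathlib

open scoped ENNReal InnerProductSpace

noncomputable section

namespace AreaLaw

/-! ### Hilbert spaces of lattice systems

The Hilbert space of one site is `ℓ²(ι)` (every Hilbert space is of this form, `ι` labelling an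
orthonormal basis; `ι` may be finite or infinite). The Hilbert space of a finite set `s` of sites is
the tensor product of `s` copies, which is `ℓ²(s → ι)`: square-summable functions of the
configurations `s → ι`. -/

/-- The lattice `{1, …, n}^d` with periodic boundary conditions. -/
abbrev Lattice (d n : ℕ) : Type := Fin d → ZMod n

/-- `ℓ²(α)` with complex coefficients. -/
abbrev L2 (α : Type) : Type := lp (fun _ : α => ℂ) 2

/-- The Hilbert space of the sites in `s`, the tensor product of `s` copies of `ℓ²(ι)`. -/
abbrev HSpace (s ι : Type) : Type := L2 (s → ι)

/-- Unbounded operators on `E`: linear maps defined on a subspace of `E`. -/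
abbrev UOp (E : Type) [AddCommGroup E] [Module ℂ E] : Type := E →ₗ.[ℂ] E

theorem memlp_comp {α β : Type} (f : α → β) (hf : Function.Injective f) (ψ : L2 β) :
    Memℓp (fun a => (ψ (f a) : ℂ)) 2 := by
  have h := lp.memℓp ψ
  rw [memℓp_gen_iff (by norm_num)] at h ⊢
  exact h.comp_injective hf

/-- The function `a ↦ ψ (f a)` for an injective map `f`. -/
def pull {α β : Type} (f : α → β) (hf : Function.Injective f) : L2 β →ₗ[ℂ] L2 α where
  toFun ψ := ⟨fun a => ψ (f a), memlp_comp f hf ψ⟩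
  map_add' _ _ := rfl
  map_smul' _ _ := rfl

theorem pull_apply {α β : Type} (f : α → β) (hf : Function.Injective f) (ψ : L2 β) (a : α) :
    pull f hf ψ a = ψ (f a) := rfl

theorem extend_injective {s t ι : Type} (e : s → t) (he : Function.Injective e) (z : t → ι) :
    Function.Injective (fun x : s → ι => Function.extend e x z) := by
  intro x y h
  funext a
  have := congrFun h (e a)
  simpa [he.extend_apply] using this

/-- The slice `x ↦ ψ (x, z)` of a vector, where `x` runs through the configurations of the sites
`e s ⊆ t`, and all other sites of `t` are in the configuration `z`. -/
def slice {s t ι : Type} (e : s → t) (he : Function.Injective e) (z : t → ι) :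
    HSpace t ι →ₗ[ℂ] HSpace s ι :=
  pull (fun x => Function.extend e x z) (extend_injective e he z)

/-- The graph of `O ⊗ 1`. -/
def ampGraph {s t ι : Type} (e : s → t) (he : Function.Injective e) (O : UOp (HSpace s ι)) :
    Submodule ℂ (HSpace t ι × HSpace t ι) where
  carrier := {p | ∀ z : t → ι, (slice e he z p.1, slice e he z p.2) ∈ O.graph}
  add_mem' := by
    intro p q hp hq z
    simpa using O.graph.add_mem (hp z) (hq z)
  zero_mem' := by
    intro z
    simp
  smul_mem' := by
    intro c p hp z
    simpa using O.graph.smul_mem c (hp z)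

/-- The operator `O ⊗ 1` on the sites `t`, where `O` acts on the sites `s`, placed in `t` by `e`.
On its natural domain, `((O ⊗ 1) ψ) (·, z) = O (ψ (·, z))` for every configuration `z` of the other
sites. -/
def amp {s t ι : Type} (e : s → t) (he : Function.Injective e) (O : UOp (HSpace s ι)) :
    UOp (HSpace t ι) :=
  (ampGraph e he O).toLinearPMap

theorem amp_graph {s t ι : Type} (e : s → t) (he : Function.Injective e)
    (O : UOp (HSpace s ι)) : (amp e he O).graph = ampGraph e he O := by
  refine Submodule.toLinearPMap_graph_eq _ ?_
  rintro ⟨x, y⟩ h hx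
  have hx' : x = 0 := hx
  subst hx'
  ext z
  have hz : slice e he z y = 0 := by
    have := h z
    simp only [map_zero] at this
    exact LinearPMap.graph_fst_eq_zero_snd O this rfl
  have h2 := congrArg (fun v : HSpace s ι => v (z ∘ e)) hz
  have h3 : Function.extend e (z ∘ e) z = z := by
    funext b
    by_cases hb : ∃ a, e a = b
    · obtain ⟨a, rfl⟩ := hb
      simp [he.extend_apply]
    · simp [Function.extend_apply' _ _ _ hb]
  simpa [slice, pull_apply, h3] using h2

/-- The graph of the product `X Y`. -/
def mulGraph {E : Type} [AddCommGroup E] [Module ℂ E] (X Y : UOp E) : Submodule ℂ (E × E) where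
  carrier := {p | ∃ y, (p.1, y) ∈ Y.graph ∧ (y, p.2) ∈ X.graph}
  add_mem' := by
    rintro p q ⟨y, h1, h2⟩ ⟨y', h1', h2'⟩
    exact ⟨y + y', by simpa using Y.graph.add_mem h1 h1', by simpa using X.graph.add_mem h2 h2'⟩
  zero_mem' := ⟨0, by simp, by simp⟩
  smul_mem' := by
    rintro c p ⟨y, h1, h2⟩
    exact ⟨c • y, by simpa using Y.graph.smul_mem c h1, by simpa using X.graph.smul_mem c h2⟩

/-- The product `X Y` of unbounded operators, with domain `{ψ ∈ dom Y | Y ψ ∈ dom X}`. -/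
def mulOp {E : Type} [AddCommGroup E] [Module ℂ E] (X Y : UOp E) : UOp E :=
  (mulGraph X Y).toLinearPMap

theorem mulOp_graph {E : Type} [AddCommGroup E] [Module ℂ E] (X Y : UOp E) :
    (mulOp X Y).graph = mulGraph X Y := by
  refine Submodule.toLinearPMap_graph_eq _ ?_
  rintro ⟨x, w⟩ ⟨y, h1, h2⟩ hx
  have hy := LinearPMap.graph_fst_eq_zero_snd Y h1 hx
  exact LinearPMap.graph_fst_eq_zero_snd X h2 hy

/-! ### Expectation values and covariances in a pure state -/

section Expectation

variable {E : Type} [NormedAddCommGroup E] [InnerProductSpace ℂ E]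

open Classical in
/-- The expectation value `⟨ψ, X ψ⟩` (meant for `ψ` in the domain of `X`). -/
def expect (X : UOp E) (ψ : E) : ℂ :=
  if h : ψ ∈ X.domain then ⟪ψ, X ⟨ψ, h⟩⟫_ℂ else 0

/-- The operator `X - ⟨X⟩`. -/
def centered (X : UOp E) (ψ : E) : UOp E :=
  (-(expect X ψ • (LinearMap.id : E →ₗ[ℂ] E))) +ᵥ X

/-- `Cov (X†, Y) = ⟨(X† - ⟨X†⟩)† (Y - ⟨Y⟩)⟩ = ⟨(X - ⟨X⟩) (Y - ⟨Y⟩)⟩` in the state `ψ`. -/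
def covAdj (X Y : UOp E) (ψ : E) : ℂ :=
  expect (mulOp (centered X ψ) (centered Y ψ)) ψ

end Expectation

/-! ### Geometry of the lattice -/

section Geometry

variable {d n : ℕ}

/-- The sites at distance at most one from `i`. -/
def nbhd (i : Lattice d n) : Set (Lattice d n) :=
  {j | j = i ∨ ∃ δ : Fin d, j = i + Pi.single δ 1 ∨ j = i - Pi.single δ 1}

/-- The cube of edge length `l` with lowest corner `a`. -/
def cube (a : Lattice d n) (l : ℕ) : Set (Lattice d n) :=
  {x | ∀ δ, (x δ - a δ).val < l}

/-- The interior of the cube: it omits the outermost layer. -/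
def cubeInterior (a : Lattice d n) (l : ℕ) : Set (Lattice d n) :=
  {x | ∀ δ, 1 ≤ (x δ - a δ).val ∧ (x δ - a δ).val + 1 < l}

/-- The boundary layer of the cube. -/
def cubeBoundary (a : Lattice d n) (l : ℕ) : Set (Lattice d n) :=
  cube a l \ cubeInterior a l

/-- The operator on the whole lattice obtained by translating by `i` the operator `O`, which acts
on the sites in `P`. -/
def opAt {ι : Type} (P : Set (Lattice d n)) (O : UOp (HSpace P ι)) (i : Lattice d n) :
    UOp (HSpace (Lattice d n) ι) :=
  amp (fun j : P => i + (j : Lattice d n))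
    (fun _ _ h => Subtype.ext (add_left_cancel h)) O

/-- The operator on the whole lattice given by an operator on the sites in `A`. -/
def opOn {ι : Type} (A : Set (Lattice d n)) (O : UOp (HSpace A ι)) :
    UOp (HSpace (Lattice d n) ι) :=
  amp (fun j : A => (j : Lattice d n)) Subtype.val_injective O

end Geometry

/-! ### Hamiltonian, thermal states -/

/-- The sum `∑ᵢ Hᵢ + ∑ᵢ H_{B(i)}` on its natural domain, where `Hᵢ` is the translate by `i` of the
on-site operator `H₁`, and `H_{B(i)}` is the translate by `i` of the operator `K` on the
neighbourhood of the origin. -/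
def localSum {d n : ℕ} [NeZero n] {ι : Type} (H₁ : UOp (HSpace ({0} : Set (Lattice d n)) ι))
    (K : UOp (HSpace (nbhd (0 : Lattice d n)) ι)) : UOp (HSpace (Lattice d n) ι) :=
  ∑ i : Lattice d n, opAt {0} H₁ i + ∑ i : Lattice d n, opAt (nbhd 0) K i

/-- An orthonormal basis of eigenvectors of `H`, with the eigenvalues. -/
structure EigenData {E : Type} [NormedAddCommGroup E] [InnerProductSpace ℂ E]
    (H : UOp E) (κ : Type) where
  basis : HilbertBasis κ ℂ E
  energy : κ → ℝ
  mem_graph : ∀ k, (basis k, (energy k : ℂ) • basis k) ∈ H.graph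

/-- The partition function `tr (exp (-H / T))`, from the eigenvalues of `H`. -/
def partitionFn {κ : Type} (E : κ → ℝ) (T : ℝ) : ℝ :=
  ∑' k, Real.exp (-E k / T)

/-- The energy density `u(T) = tr (H ρ_T) / N` of the thermal state
`ρ_T = exp (-H / T) / tr (exp (-H / T))` of a system of `N` sites, from the eigenvalues of `H`. -/
def energyDensity {κ : Type} (E : κ → ℝ) (N : ℝ) (T : ℝ) : ℝ :=
  (∑' k, E k * (Real.exp (-E k / T) / partitionFn E T)) / N

/-- The specific heat capacity `c(T) = u'(T)`. -/
def specificHeat {κ : Type} (E : κ → ℝ) (N : ℝ) (T : ℝ) : ℝ :=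
  deriv (energyDensity E N) T

/-- The dimension of the eigenspace of energy zero. -/
def groundDegeneracy {κ : Type} (E : κ → ℝ) : ℕ :=
  Nat.card {k : κ // E k = 0}

/-! ### Reduced states and entropy -/

/-- The configuration equal to `x` on `R` and to `z` off `R`. -/
def glue {t ι : Type} (R : Set t) (x : R → ι) (z : (Rᶜ : Set t) → ι) : t → ι :=
  open Classical in fun j => if h : j ∈ R then x ⟨j, h⟩ else z ⟨j, h⟩

theorem glue_injective {t ι : Type} (R : Set t) (z : (Rᶜ : Set t) → ι) :
    Function.Injective (fun x : R → ι => glue R x z) := by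
  intro x y h
  funext a
  have := congrFun h a
  simpa [glue] using this

/-- The reduced density operator of the pure state `ψ` on `R`: the partial trace
`∑_z |ψ(·, z)⟩⟨ψ(·, z)|` over the configurations `z` of the complement of `R`. -/
def reducedState {t ι : Type} (ψ : HSpace t ι) (R : Set t) : HSpace R ι →L[ℂ] HSpace R ι :=
  ∑' z : (Rᶜ : Set t) → ι,
    InnerProductSpace.rankOne ℂ (pull (fun x => glue R x z) (glue_injective R z) ψ)
      (pull (fun x => glue R x z) (glue_injective R z) ψ)

/-- The von Neumann entropy `-tr (ρ log ρ)` of a density operator: the sum of `-p log p` over the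
eigenvalues `p` with their multiplicities. -/
def entropy {E : Type} [NormedAddCommGroup E] [InnerProductSpace ℂ E] (ρ : E →L[ℂ] E) : ℝ≥0∞ :=
  ∑' p : ℝ, (Module.finrank ℂ (Module.End.eigenspace (ρ : E →ₗ[ℂ] E) (p : ℂ)) : ℝ≥0∞) *
    ENNReal.ofReal (Real.negMulLog p)

/-- The state `|ψ⟩⟨ψ|` is invariant under all translations of the lattice. -/
def TranslationInvariant {d n : ℕ} {ι : Type} (ψ : HSpace (Lattice d n) ι) : Prop :=
  ∀ (v : Lattice d n) (x y : Lattice d n → ι),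
    ψ (fun j => x (j + v)) * star (ψ (fun j => y (j + v))) = ψ x * star (ψ y)

/-! ### The strength of the coupling between a cube and its complement -/

/-- A decomposition `H_{B(i)} = ∑ₖ h_A⁽ᵏ⁾ ⊗ h_B⁽ᵏ⁾` into closed operators, `h_A⁽ᵏ⁾` acting on
`A = B(i) ∩ R` and `h_B⁽ᵏ⁾` on (at most) one site of `B = B(i) \ R`. The sum on its natural domain
is a restriction of `H_{B(i)}`. -/
structure CutDecomposition {d n : ℕ} {ι : Type} (K : UOp (HSpace (nbhd (0 : Lattice d n)) ι))
    (R : Set (Lattice d n)) (i : Lattice d n) where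
  len : ℕ
  hA : Fin len → UOp (HSpace (nbhd i ∩ R : Set (Lattice d n)) ι)
  hA_closed : ∀ k, (hA k).IsClosed
  suppB : Fin len → Set (Lattice d n)
  suppB_subset : ∀ k, suppB k ⊆ nbhd i \ R
  suppB_single : ∀ k, (suppB k).Subsingleton
  hB : ∀ k, UOp (HSpace (suppB k) ι)
  hB_closed : ∀ k, (hB k).IsClosed
  sum_le : ∑ k, mulOp (opOn (nbhd i ∩ R) (hA k)) (opOn (suppB k) (hB k)) ≤ opAt (nbhd 0) K i

namespace CutDecomposition

variable {d n : ℕ} {ι : Type} {K : UOp (HSpace (nbhd (0 : Lattice d n)) ι)}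
  {R : Set (Lattice d n)} {i : Lattice d n}

/-- The expectation values `⟨h_A h_B⟩`, `⟨h_A⟩`, `⟨h_B⟩` in the state `ψ` are defined. -/
def Admissible (D : CutDecomposition K R i) (ψ : HSpace (Lattice d n) ι) : Prop :=
  ∀ k, ψ ∈ (mulOp (opOn (nbhd i ∩ R) (D.hA k)) (opOn (D.suppB k) (D.hB k))).domain ∧
    ψ ∈ (opOn (nbhd i ∩ R) (D.hA k)).domain

/-- `|∑ₖ Cov (h_A⁽ᵏ⁾†, h_B⁽ᵏ⁾)|` in the state `ψ`. -/
def absCov (D : CutDecomposition K R i) (ψ : HSpace (Lattice d n) ι) : ℝ :=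
  ‖∑ k, covAdj (opOn (nbhd i ∩ R) (D.hA k)) (opOn (D.suppB k) (D.hB k)) ψ‖

end CutDecomposition

/-- `h` is the coupling strength for the cube with corner `a` and edge length `l`: either `H_{B(i)}`
is bounded and `h = ‖H_{B(i)}‖`, or `h = h(ρ)` is the maximum over the boundary sites `i` of
`|∑ₖ Cov (h_A⁽ᵏ⁾†, h_B⁽ᵏ⁾)|` for some decompositions of the `H_{B(i)}`. -/
def IsCouplingStrength {d n : ℕ} {ι : Type} (K : UOp (HSpace (nbhd (0 : Lattice d n)) ι))
    (ψ : HSpace (Lattice d n) ι) (a : Lattice d n) (l : ℕ) (h : ℝ) : Prop :=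
  (∃ B : HSpace (nbhd (0 : Lattice d n)) ι →L[ℂ] HSpace (nbhd (0 : Lattice d n)) ι,
      K = (B : HSpace (nbhd (0 : Lattice d n)) ι →ₗ[ℂ] _).toPMap ⊤ ∧ h = ‖B‖) ∨
  (∃ D : ∀ i : cubeBoundary a l, CutDecomposition K (cube a l) (i : Lattice d n),
      (∀ i, (D i).Admissible ψ) ∧ h = ⨆ i, (D i).absCov ψ)

end AreaLaw

end

open AreaLaw

/-! The torus splits into (n/l)^d translates of R. Let σ be the product over all these blocks of
copies of ρ_R. Its entropy is (n/l)^d S(ρ_R), and the Gibbs variational principle gives S(σ) ≤ log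
Z_T + tr(Hσ)/T for every T > 0. So it suffices to bound the energy of σ and to choose T well.

Energy. Passing from ψ to σ leaves the expectation of every term supported inside one block
unchanged. Only the couplings centred on boundary layers change. There are at most 2d n^d/l of them
(`sum_boundary_le`) and each gains at most 2h (`exists_hasExpect_blocks`), so tr(Hσ) ≤ (C + 4dh)
n^d/l, which is the thermal energy at T_c. For a coupling ∑ h_A ⊗ h_B, the two factors become
independent in σ, and the change is exactly minus the sum of covariances.

Unbounded operators make expectations in a mixed state awkward, so σ is purified: |M| copies of ψ
live on M × Λ, with M indexing the blocks, and tracing out the complement of R in every copy leaves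
σ. The map `blockEmb` places the lattice into M × Λ. Operators are handled through graphs:
`HasExpect` asserts that the vector lies in the domain of the amplified operator and records the
value. The slices of the purification then lie in the domain of H, and `hasSum_energy` computes
tr(Hσ) in the eigenbasis of H.

Entropy. No operator logarithm is used. `sum_negMulLog_le` proves the variational principle for
finitely many eigenvectors, with an error term for the missing mass. `entropy_le_of_tensorPower`
applies it to product eigenvectors and lets the missing mass tend to zero.

Thermodynamics. Write U(T) = N u(T). Since U' = N c and (log Z)' = U/T², with U → 0 and log Z → log
D as T → 0, a bound on c integrates twice to a bound on log Z_T. `exists_gibbs_bound_of_exp` and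
`exists_gibbs_bound_of_rpow` then choose T so that log Z_T - log D and U(T_c)/T are both under
control. The two choices yield the logarithm and the exponent 1/(γ+1). -/

namespace AreaLaw

open Filter Topology Set

/-! ### Thermodynamics: from specific heat to free energy -/

section Thermodynamics

variable {κ : Type} {E : κ → ℝ}

/-- Boltzmann weights with a polynomial prefactor are dominated by weights at half the inverse
temperature. -/
theorem pow_mul_exp_neg_le {b : ℝ} (hb : 0 < b) (m : ℕ) :
    ∃ c : ℝ, 0 ≤ c ∧ ∀ x : ℝ, 0 ≤ x → x ^ m * Real.exp (-(b * x)) ≤ c * Real.exp (-(b / 2 * x)) := by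
  refine ⟨(m.factorial : ℝ) / (b / 2) ^ m, by positivity, fun x hx => ?_⟩
  have h := Real.pow_div_factorial_le_exp (b / 2 * x) (by positivity) m
  rw [mul_pow, div_le_iff₀ (by positivity)] at h
  have h2 : Real.exp (-(b * x)) = Real.exp (-(b / 2 * x)) * Real.exp (-(b / 2 * x)) := by
    rw [← Real.exp_add]; ring_nf
  have h3 : Real.exp (b / 2 * x) * Real.exp (-(b / 2 * x)) = 1 := by rw [← Real.exp_add]; simp
  have h4 := Real.exp_pos (-(b / 2 * x))
  rw [h2, ← mul_assoc]
  refine mul_le_mul_of_nonneg_right ?_ h4.le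
  rw [le_div_iff₀ (by positivity)]
  calc x ^ m * Real.exp (-(b / 2 * x)) * (b / 2) ^ m
      = ((b / 2) ^ m * x ^ m) * Real.exp (-(b / 2 * x)) := by ring
    _ ≤ (Real.exp (b / 2 * x) * m.factorial) * Real.exp (-(b / 2 * x)) := by gcongr
    _ = m.factorial := by rw [mul_right_comm, h3, one_mul]

/-- All thermal states exist, and the energies are nonnegative. -/
structure Thermal (E : κ → ℝ) : Prop where
  nonneg : ∀ j, 0 ≤ E j
  summable : ∀ T : ℝ, 0 < T → Summable fun j => Real.exp (-E j / T)

namespace Thermal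

theorem summable_exp (hE : Thermal E) {b : ℝ} (hb : 0 < b) :
    Summable fun j => Real.exp (-(b * E j)) := by
  refine (hE.summable (1 / b) (by positivity)).congr fun j => ?_
  congr 1
  field_simp

theorem exists_bound (hE : Thermal E) {b : ℝ} (hb : 0 < b) (m : ℕ) :
    ∃ u : κ → ℝ, Summable u ∧ ∀ j y, b ≤ y → E j ^ m * Real.exp (-(y * E j)) ≤ u j := by
  obtain ⟨c, hc, h⟩ := pow_mul_exp_neg_le hb m
  refine ⟨fun j => c * Real.exp (-(b / 2 * E j)), (hE.summable_exp (by positivity)).mul_left c,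
    fun j y hy => le_trans ?_ (h _ (hE.nonneg j))⟩
  have := hE.nonneg j
  gcongr

theorem summable_pow_mul_exp (hE : Thermal E) {b : ℝ} (hb : 0 < b) (m : ℕ) :
    Summable fun j => E j ^ m * Real.exp (-(b * E j)) := by
  obtain ⟨u, hu, h⟩ := hE.exists_bound hb m
  exact Summable.of_nonneg_of_le
    (fun j => mul_nonneg (pow_nonneg (hE.nonneg j) _) (Real.exp_pos _).le)
    (fun j => h j b le_rfl) hu

/-- Termwise differentiation is legitimate because on inverse temperatures above b/2 the
differentiated series has one summable majorant. -/
theorem hasDerivAt_moment (hE : Thermal E) {b : ℝ} (hb : 0 < b) (m : ℕ) :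
    HasDerivAt (fun b => ∑' j, E j ^ m * Real.exp (-(b * E j)))
      (-∑' j, E j ^ (m + 1) * Real.exp (-(b * E j))) b := by
  obtain ⟨u, hu, h⟩ := hE.exists_bound (half_pos hb) (m + 1)
  have := hasDerivAt_tsum_of_isPreconnected (t := Ioi (b / 2)) (y₀ := b) (y := b) hu isOpen_Ioi
    isPreconnected_Ioi (g := fun j b => E j ^ m * Real.exp (-(b * E j)))
    (g' := fun j b => -(E j ^ (m + 1) * Real.exp (-(b * E j))))
    (fun j y _ => by
      have h1 : HasDerivAt (fun y : ℝ => -(y * E j)) (-(1 * E j)) y :=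
        ((hasDerivAt_id y).mul_const (E j)).neg
      have h2 := (h1.exp).const_mul (E j ^ m)
      exact h2.congr_deriv (by ring))
    (fun j y hy => by
      rw [norm_neg, Real.norm_of_nonneg
        (mul_nonneg (pow_nonneg (hE.nonneg j) _) (Real.exp_pos _).le)]
      exact h j y (le_of_lt hy))
    (by simpa using hb) (hE.summable_pow_mul_exp hb m) (by simpa using hb)
  rwa [tsum_neg] at this

theorem partitionFn_eq (T : ℝ) :
    partitionFn E T = ∑' j, E j ^ 0 * Real.exp (-(T⁻¹ * E j)) := by
  simp only [partitionFn, pow_zero, one_mul]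
  refine tsum_congr fun j => ?_
  congr 1
  ring

/-- The thermal energy `tr (H ρ_T)`. -/
noncomputable def _root_.AreaLaw.meanEnergy (E : κ → ℝ) (T : ℝ) : ℝ :=
  (∑' j, E j ^ 1 * Real.exp (-(T⁻¹ * E j))) / partitionFn E T

theorem energyDensity_eq (N T : ℝ) : energyDensity E N T = meanEnergy E T / N := by
  rw [energyDensity, meanEnergy]
  congr 1
  rw [← tsum_div_const]
  refine tsum_congr fun j => ?_
  rw [pow_one, mul_div_assoc]
  congr 3
  ring

variable (hE : Thermal E) (h0 : ∃ j, E j = 0)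

include hE h0 in
theorem one_le_partitionFn {T : ℝ} (hT : 0 < T) : 1 ≤ partitionFn E T := by
  obtain ⟨j, hj⟩ := h0
  have := (hE.summable T hT).le_tsum j (fun i _ => (Real.exp_pos _).le)
  rw [partitionFn]
  simpa [hj] using this

include hE h0 in
theorem partitionFn_pos {T : ℝ} (hT : 0 < T) : 0 < partitionFn E T :=
  lt_of_lt_of_le one_pos (hE.one_le_partitionFn h0 hT)

include hE in
theorem hasDerivAt_moment_inv {T : ℝ} (hT : 0 < T) (m : ℕ) :
    HasDerivAt (fun T : ℝ => ∑' j, E j ^ m * Real.exp (-(T⁻¹ * E j)))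
      ((∑' j, E j ^ (m + 1) * Real.exp (-(T⁻¹ * E j))) / T ^ 2) T := by
  have h1 := hE.hasDerivAt_moment (inv_pos.2 hT) m
  have h2 := h1.comp T (hasDerivAt_inv hT.ne')
  exact h2.congr_deriv (by field_simp)

include hE h0 in
theorem hasDerivAt_log_partitionFn {T : ℝ} (hT : 0 < T) :
    HasDerivAt (fun T => Real.log (partitionFn E T)) (meanEnergy E T / T ^ 2) T := by
  have h1 := (hE.hasDerivAt_moment_inv hT 0)
  have h2 : HasDerivAt (partitionFn E)
      ((∑' j, E j ^ (0 + 1) * Real.exp (-(T⁻¹ * E j))) / T ^ 2) T := by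
    refine h1.congr_of_eventuallyEq (Eventually.of_forall fun T => partitionFn_eq T)
  have h3 := h2.log (hE.partitionFn_pos h0 hT).ne'
  exact h3.congr_deriv (by rw [meanEnergy]; ring)

include hE h0 in
theorem differentiableAt_meanEnergy {T : ℝ} (hT : 0 < T) :
    DifferentiableAt ℝ (meanEnergy E) T := by
  have h1 := (hE.hasDerivAt_moment_inv hT 1).differentiableAt
  have h2 := (hE.hasDerivAt_moment_inv hT 0).differentiableAt
  have h3 : DifferentiableAt ℝ (partitionFn E) T :=
    h2.congr_of_eventuallyEq (Eventually.of_forall fun T => partitionFn_eq T)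
  exact h1.div h3 (hE.partitionFn_pos h0 hT).ne'

-- Dominated convergence with the terms at T = 1 as the scale of the majorant: only ground states
-- survive. The factor `0 ^ m` makes one statement serve both the partition function (m = 0) and the
-- energy (m = 1).
include hE in
theorem tendsto_moment (m : ℕ) :
    Tendsto (fun T : ℝ => ∑' j, E j ^ m * Real.exp (-(T⁻¹ * E j))) (𝓝[>] 0)
      (𝓝 (∑' j, if E j = 0 then (0 : ℝ) ^ m else 0)) := by
  obtain ⟨u, hu, h⟩ := hE.exists_bound one_pos m
  refine tendsto_tsum_of_dominated_convergence hu (fun j => ?_) ?_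
  · by_cases hj : E j = 0
    · simp [hj]
    · have hpos : 0 < E j := lt_of_le_of_ne (hE.nonneg j) (Ne.symm hj)
      have h1 : Tendsto (fun T : ℝ => T⁻¹ * E j) (𝓝[>] 0) atTop :=
        tendsto_inv_nhdsGT_zero.atTop_mul_const hpos
      have h2 := (Real.tendsto_exp_neg_atTop_nhds_zero.comp h1).const_mul (E j ^ m)
      simpa [hj] using h2
  · have : ∀ᶠ T : ℝ in 𝓝[>] 0, T ∈ Ioo (0 : ℝ) 1 := Ioo_mem_nhdsGT one_pos
    filter_upwards [this] with T hT j
    rw [Real.norm_of_nonneg (mul_nonneg (pow_nonneg (hE.nonneg j) _) (Real.exp_pos _).le)]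
    exact h j _ ((one_le_inv₀ hT.1).2 hT.2.le)

-- Summable Boltzmann weights tend to zero along the cofinite filter, whereas every ground state has
-- weight one.
include hE in
theorem finite_ground : {j | E j = 0}.Finite := by
  have h := (hE.summable 1 one_pos).tendsto_cofinite_zero
  have h2 := h.eventually (gt_mem_nhds (show (0 : ℝ) < 1 by norm_num))
  rw [eventually_cofinite] at h2
  refine h2.subset fun j hj => ?_
  have : E j = 0 := hj
  simp [this]

include hE in
theorem tsum_ground : ∑' j, (if E j = 0 then (0 : ℝ) ^ 0 else 0) = groundDegeneracy E := by
  rw [groundDegeneracy, tsum_eq_sum (s := hE.finite_ground.toFinset)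
    (fun j hj => by simpa using hj)]
  rw [Finset.sum_congr rfl (g := fun _ => (1 : ℝ)) (fun j hj => by simpa using hj)]
  have := Nat.card_coe_set_eq {j | E j = 0}
  rw [Set.ncard_eq_toFinset_card _ hE.finite_ground] at this
  simp [← this]
  rfl

include hE h0 in
theorem groundDegeneracy_pos : 0 < groundDegeneracy E := by
  have : Finite {j // E j = 0} := hE.finite_ground
  have : Nonempty {j // E j = 0} := let ⟨j, hj⟩ := h0; ⟨⟨j, hj⟩⟩
  exact Nat.card_pos

include hE in
theorem tendsto_partitionFn :
    Tendsto (partitionFn E) (𝓝[>] 0) (𝓝 (groundDegeneracy E)) := by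
  have := hE.tendsto_moment 0
  rw [hE.tsum_ground] at this
  exact this.congr fun T => (partitionFn_eq T).symm

include hE h0 in
theorem tendsto_log_partitionFn :
    Tendsto (fun T => Real.log (partitionFn E T)) (𝓝[>] 0)
      (𝓝 (Real.log (groundDegeneracy E))) :=
  hE.tendsto_partitionFn.log (by exact_mod_cast (hE.groundDegeneracy_pos h0).ne')

include hE h0 in
theorem tendsto_meanEnergy : Tendsto (meanEnergy E) (𝓝[>] 0) (𝓝 0) := by
  have h1 := (hE.tendsto_moment 1).div hE.tendsto_partitionFn
    (by exact_mod_cast (hE.groundDegeneracy_pos h0).ne')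
  simp only [pow_one, ite_self, tsum_zero, zero_div] at h1
  exact h1.congr fun T => by simp [meanEnergy]

end Thermal

/-- Comparison of two functions on an interval by their derivatives. -/
theorem le_of_deriv_le_of_tendsto {f g f' g' : ℝ → ℝ} {a b T : ℝ}
    (hf : ∀ t, 0 < t → t ≤ T → HasDerivAt f (f' t) t)
    (hg : ∀ t, 0 < t → t ≤ T → HasDerivAt g (g' t) t)
    (hfg : ∀ t, 0 < t → t ≤ T → f' t ≤ g' t)
    (hfa : Tendsto f (𝓝[>] 0) (𝓝 a)) (hgb : Tendsto g (𝓝[>] 0) (𝓝 b)) (hT : 0 < T) :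
    f T - a ≤ g T - b := by
  have hd : ∀ t ∈ Ioc 0 T, HasDerivAt (fun t => f t - g t) (f' t - g' t) t :=
    fun t ht => (hf t ht.1 ht.2).sub (hg t ht.1 ht.2)
  -- The functions are only controlled for t > 0, so the value at 0 is replaced by a one-sided limit
  -- of the antitone difference.
  have hanti : AntitoneOn (fun t => f t - g t) (Ioc 0 T) := by
    refine antitoneOn_of_deriv_nonpos (convex_Ioc 0 T)
      (fun t ht => (hd t ht).continuousAt.continuousWithinAt)
      (fun t ht => ((hd t (interior_subset ht)).differentiableAt).differentiableWithinAt)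
      (fun t ht => ?_)
    have ht' := interior_subset ht
    rw [(hd t ht').deriv]
    linarith [hfg t ht'.1 ht'.2]
  have hlim : Tendsto (fun t => f t - g t) (𝓝[>] 0) (𝓝 (a - b)) := hfa.sub hgb
  have : f T - g T ≤ a - b := by
    refine ge_of_tendsto hlim ?_
    filter_upwards [Ioc_mem_nhdsGT hT] with t ht
    exact hanti ht ⟨hT, le_rfl⟩ ht.2
  linarith

namespace Thermal

variable (hE : Thermal E) (h0 : ∃ j, E j = 0)

include hE h0 in
/-- A bound on the specific heat bounds the energy. -/
theorem meanEnergy_le {N T : ℝ} (hN : 0 < N) (hT : 0 < T) {G g : ℝ → ℝ}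
    (hc : ∀ t, 0 < t → t ≤ T → specificHeat E N t ≤ g t)
    (hG : ∀ t, 0 < t → t ≤ T → HasDerivAt G (g t) t) (hG0 : Tendsto G (𝓝[>] 0) (𝓝 0)) :
    meanEnergy E T ≤ N * G T := by
  have h := le_of_deriv_le_of_tendsto (f := meanEnergy E) (g := fun t => N * G t) (T := T)
    (fun t ht _ => (hE.differentiableAt_meanEnergy h0 ht).hasDerivAt)
    (fun t ht htT => (hG t ht htT).const_mul N)
    (fun t ht htT => ?_) (hE.tendsto_meanEnergy h0) (hG0.const_mul N) hT
  · simpa using h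
  · have h1 := hc t ht htT
    have h2 : energyDensity E N = fun T => meanEnergy E T / N := by
      funext T; exact energyDensity_eq N T
    rw [specificHeat, h2, deriv_div_const, div_le_iff₀ hN] at h1
    linarith

include hE h0 in
/-- A bound on the energy bounds the logarithm of the partition function. -/
theorem log_partitionFn_le {N T : ℝ} (hT : 0 < T) {L f : ℝ → ℝ}
    (hU : ∀ t, 0 < t → t ≤ T → meanEnergy E t ≤ N * (f t * t ^ 2))
    (hL : ∀ t, 0 < t → t ≤ T → HasDerivAt L (f t) t) (hL0 : Tendsto L (𝓝[>] 0) (𝓝 0)) :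
    Real.log (partitionFn E T) ≤ Real.log (groundDegeneracy E) + N * L T := by
  have h := le_of_deriv_le_of_tendsto (f := fun t => Real.log (partitionFn E t))
    (g := fun t => N * L t) (T := T)
    (fun t ht _ => hE.hasDerivAt_log_partitionFn h0 ht)
    (fun t ht htT => (hL t ht htT).const_mul N)
    (fun t ht htT => ?_) (hE.tendsto_log_partitionFn h0) (hL0.const_mul N) hT
  · simp only [mul_zero, sub_zero] at h
    linarith
  · rw [div_le_iff₀ (by positivity)]
    linarith [hU t ht htT]

end Thermal

/-- Half of the exponential absorbs the power. With x = Δ/T this removes the prefactor (Δ/T)^γ from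
the specific heat at the price of halving the gap. -/
theorem rpow_mul_exp_neg_le (γ : ℝ) :
    ∃ c : ℝ, 0 < c ∧ ∀ x : ℝ, 1 ≤ x → x ^ γ * Real.exp (-x) ≤ c * Real.exp (-(x / 2)) := by
  obtain ⟨m, hm⟩ := exists_nat_ge γ
  obtain ⟨c, hc, h⟩ := pow_mul_exp_neg_le one_pos m
  refine ⟨c + 1, by linarith, fun x hx => ?_⟩
  have h1 : x ^ γ ≤ x ^ m := by
    rw [← Real.rpow_natCast]; exact Real.rpow_le_rpow_of_exponent_le hx hm
  have h2 := h x (by linarith)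
  rw [one_mul, one_div_mul_eq_div] at h2
  have h3 := Real.exp_pos (-x)
  have h4 := Real.exp_pos (-(x / 2))
  nlinarith

theorem hasDerivAt_exp_neg_div {a t : ℝ} (ht : 0 < t) :
    HasDerivAt (fun t => Real.exp (-(a / t))) (a / t ^ 2 * Real.exp (-(a / t))) t := by
  have h1 : HasDerivAt (fun t => -(a / t)) (a / t ^ 2) t := by
    have := ((hasDerivAt_inv ht.ne').const_mul a).neg
    exact this.congr_deriv (by simp [div_eq_mul_inv])
  exact h1.exp.congr_deriv (by ring)

theorem tendsto_exp_neg_div {a : ℝ} (ha : 0 < a) :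
    Tendsto (fun t => Real.exp (-(a / t))) (𝓝[>] 0) (𝓝 0) := by
  have h1 : Tendsto (fun T : ℝ => a * T⁻¹) (𝓝[>] 0) atTop :=
    tendsto_inv_nhdsGT_zero.const_mul_atTop ha
  exact Real.tendsto_exp_neg_atTop_nhds_zero.comp h1

/-- The thermodynamic bound for an exponentially small specific heat. -/
theorem exists_gibbs_bound_of_exp {γ k Δ a : ℝ} (hk : 0 < k) (hΔ : 0 < Δ) (ha : 0 ≤ a) :
    ∃ C' : ℝ, 0 ≤ C' ∧ ∀ {κ : Type} {E : κ → ℝ}, Thermal E → (∃ j, E j = 0) →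
      ∀ {N l Tc : ℝ}, 0 < N → 2 ≤ l → 0 < Tc → meanEnergy E Tc = N * (a / l) →
      (∀ T, 0 < T → T ≤ Tc → specificHeat E N T ≤ k * (Δ / T) ^ γ * Real.exp (-Δ / T)) →
      ∃ T, 0 < T ∧ Real.log (partitionFn E T) + N * (a / l) / T ≤
        Real.log (groundDegeneracy E) + N * (C' * (Real.log l / l)) := by
  obtain ⟨c, hc, hcx⟩ := rpow_mul_exp_neg_le γ
  -- `A` is chosen so that the derivative of A exp(-Δ/(2t)) equals k c (Δ/t)² exp(-Δ/(2t)). Since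
  -- Δ/t ≥ 1 on the range used, this dominates the specific heat while having an explicit primitive.
  set A : ℝ := 2 * Δ * (k * c) with hA
  have hApos : 0 < A := by positivity
  refine ⟨(12 * A + 4 * a) / Δ, by positivity, ?_⟩
  intro κ E hE h0 N l Tc hN hl hTc hU hsp
  have hl0 : 0 < l := by linarith
  have hlog : 1 / 2 ≤ Real.log l := by
    have := Real.log_le_log (by norm_num) hl
    linarith [Real.log_two_gt_d9]
  have hlogpos : 0 < Real.log l := by linarith
  -- Below this temperature exp(-Δ/(4T)) ≤ 1/l. The minimum with `Tc` keeps T in the range where the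
  -- specific heat is controlled.
  set T₀ : ℝ := Δ / (4 * Real.log l) with hT₀
  have hT₀pos : 0 < T₀ := by positivity
  set T : ℝ := min Tc T₀ with hT
  have hTpos : 0 < T := lt_min hTc hT₀pos
  have hTTc : T ≤ Tc := min_le_left _ _
  have hx : 4 * Real.log l ≤ Δ / T := by
    rw [le_div_iff₀ hTpos]
    calc 4 * Real.log l * T ≤ 4 * Real.log l * T₀ := by gcongr; exact min_le_right _ _
      _ = Δ := by rw [hT₀]; field_simp
  have hdiv : ∀ t, 0 < t → t ≤ T → 1 ≤ Δ / t := by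
    intro t ht htT
    have : Δ / T ≤ Δ / t := by gcongr
    linarith
  have hUle : ∀ t, 0 < t → t ≤ T → meanEnergy E t ≤ N * (A * Real.exp (-(Δ / 2 / t))) := by
    intro t ht htT
    refine hE.meanEnergy_le h0 hN ht (G := fun t => A * Real.exp (-(Δ / 2 / t)))
      (g := fun t => A * (Δ / 2 / t ^ 2 * Real.exp (-(Δ / 2 / t)))) (fun s hs hst => ?_)
      (fun s hs _ => (hasDerivAt_exp_neg_div hs).const_mul A)
      (by simpa using (tendsto_exp_neg_div (half_pos hΔ)).const_mul A)
    refine (hsp s hs (hst.trans (htT.trans hTTc))).trans ?_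
    have h1 := hdiv s hs (hst.trans htT)
    have h2 := hcx _ h1
    have e1 : -Δ / s = -(Δ / s) := by ring
    have e2 : Δ / 2 / s = Δ / s / 2 := by ring
    have e3 : A * (Δ / 2 / s ^ 2) = k * c * (Δ / s) ^ 2 := by
      rw [hA]; field_simp
    rw [e1, e2, mul_assoc, ← mul_assoc A, e3]
    have h3 : (1 : ℝ) ≤ (Δ / s) ^ 2 := one_le_pow₀ h1
    have h4 := Real.exp_pos (-(Δ / s / 2))
    calc k * ((Δ / s) ^ γ * Real.exp (-(Δ / s))) ≤ k * (c * Real.exp (-(Δ / s / 2))) := by gcongr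
      _ = k * c * 1 * Real.exp (-(Δ / s / 2)) := by ring
      _ ≤ k * c * (Δ / s) ^ 2 * Real.exp (-(Δ / s / 2)) := by gcongr
  have hinv : 1 / l = Real.exp (-Real.log l) := by rw [Real.exp_neg, Real.exp_log hl0, one_div]
  have hexp2 : Real.exp (-(Δ / 2 / T)) ≤ 1 / l := by
    rw [hinv]
    apply Real.exp_le_exp.2
    have : Δ / 2 / T = Δ / T / 2 := by ring
    rw [this]
    linarith
  have hexp4 : Real.exp (-(Δ / 4 / T)) ≤ 1 / l := by
    rw [hinv]
    apply Real.exp_le_exp.2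
    have : Δ / 4 / T = Δ / T / 4 := by ring
    rw [this]
    linarith
  have hZ : Real.log (partitionFn E T) ≤
      Real.log (groundDegeneracy E) + N * (2 * A / Δ * Real.exp (-(Δ / 2 / T))) := by
    refine hE.log_partitionFn_le h0 hTpos (L := fun t => 2 * A / Δ * Real.exp (-(Δ / 2 / t)))
      (f := fun t => 2 * A / Δ * (Δ / 2 / t ^ 2 * Real.exp (-(Δ / 2 / t)))) (fun t ht htT => ?_)
      (fun s hs _ => (hasDerivAt_exp_neg_div hs).const_mul _)
      (by simpa using (tendsto_exp_neg_div (half_pos hΔ)).const_mul (2 * A / Δ))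
    refine (hUle t ht htT).trans (le_of_eq ?_)
    field_simp
  -- If T = T₀, then 1/T is a multiple of log l. If T = Tc, there is no lower bound on T, but N a/l
  -- is the energy at Tc and hence at most N A exp(-Δ/(2T)): one half of this exponential cancels
  -- 1/T and the other half supplies 1/l.
  have hlast : N * (a / l) / T ≤ N * ((4 * a * Real.log l + 4 * A) / Δ / l) := by
    rcases le_total T₀ Tc with h | h
    · have hTe : T = T₀ := min_eq_right h
      rw [hTe, hT₀]
      have : N * (a / l) / (Δ / (4 * Real.log l)) = N * ((4 * a * Real.log l) / Δ / l) := by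
        field_simp
      rw [this]
      gcongr
      linarith
    · have hTe : T = Tc := min_eq_left h
      have h1 := hUle T hTpos le_rfl
      rw [hTe, hU, ← hTe] at h1
      have e1 : Real.exp (-(Δ / 2 / T)) = Real.exp (-(Δ / 4 / T)) * Real.exp (-(Δ / 4 / T)) := by
        rw [← Real.exp_add]; congr 1; ring
      have e2 : Real.exp (Δ / 4 / T) * Real.exp (-(Δ / 4 / T)) = 1 := by
        rw [← Real.exp_add]; simp
      have e3 := Real.add_one_le_exp (Δ / 4 / T)
      have e4 := Real.exp_pos (-(Δ / 4 / T))
      have e5 : Δ / 4 / T * Real.exp (-(Δ / 4 / T)) ≤ 1 := by nlinarith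
      calc N * (a / l) / T ≤ N * (A * Real.exp (-(Δ / 2 / T))) / T := by gcongr
        _ = N * (4 * A / Δ) * (Δ / 4 / T * Real.exp (-(Δ / 4 / T))) * Real.exp (-(Δ / 4 / T)) := by
          rw [e1]; field_simp
        _ ≤ N * (4 * A / Δ) * 1 * (1 / l) := by gcongr
        _ = N * ((4 * A) / Δ / l) := by ring
        _ ≤ _ := by
          gcongr
          have : 0 ≤ a * Real.log l := by positivity
          linarith
  refine ⟨T, hTpos, ?_⟩
  have h1 : N * (2 * A / Δ * Real.exp (-(Δ / 2 / T))) ≤ N * (2 * A / Δ * (1 / l)) := by gcongr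
  have h2 : N * (2 * A / Δ * (1 / l)) + N * ((4 * a * Real.log l + 4 * A) / Δ / l) ≤
      N * ((12 * A + 4 * a) / Δ * (Real.log l / l)) := by
    rw [← mul_add]
    gcongr
    have e1 : 2 * A / Δ * (1 / l) + (4 * a * Real.log l + 4 * A) / Δ / l =
      (6 * A + 4 * a * Real.log l) / (Δ * l) := by field_simp; ring
    have e2 : (12 * A + 4 * a) / Δ * (Real.log l / l) =
      (12 * A * Real.log l + 4 * a * Real.log l) / (Δ * l) := by field_simp
    rw [e1, e2]
    -- Uses log l ≥ 1/2, from l ≥ 2.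
    have : 6 * A ≤ 12 * A * Real.log l := by nlinarith
    gcongr
  linarith

/-- The thermodynamic bound for a specific heat bounded by a power of the temperature. -/
theorem exists_gibbs_bound_of_rpow {γ k Δ a : ℝ} (hγ : 0 < γ) (hk : 0 < k) (hΔ : 0 < Δ)
    (ha : 0 < a) :
    ∃ C' : ℝ, 0 ≤ C' ∧ ∀ {κ : Type} {E : κ → ℝ}, Thermal E → (∃ j, E j = 0) →
      ∀ {N l Tc : ℝ}, 0 < N → 2 ≤ l → 0 < Tc → meanEnergy E Tc = N * (a / l) →
      (∀ T, 0 < T → T ≤ Tc → specificHeat E N T ≤ k * (T / Δ) ^ γ) →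
      ∃ T, 0 < T ∧ Real.log (partitionFn E T) + N * (a / l) / T ≤
        Real.log (groundDegeneracy E) + N * (C' * l ^ (1 / (γ + 1) - 1)) := by
  set b : ℝ := k / ((γ + 1) * Δ ^ γ) with hb
  have hΔγ : 0 < Δ ^ γ := Real.rpow_pos_of_pos hΔ γ
  have hbpos : 0 < b := by positivity
  have hγ1 : 0 < γ + 1 := by linarith
  refine ⟨(1 + 1 / γ) * (a / (a / b) ^ (1 / (γ + 1))), by positivity, ?_⟩
  intro κ E hE h0 N l Tc hN hl hTc hU hsp
  have hl0 : 0 < l := by linarith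
  have hderiv : ∀ {s t : ℝ}, 0 < t → HasDerivAt (fun t : ℝ => t ^ (s + 1)) ((s + 1) * t ^ s) t := by
    intro s t ht
    have := Real.hasDerivAt_rpow_const (x := t) (p := s + 1) (Or.inl ht.ne')
    simpa using this
  have hlim : ∀ {s : ℝ}, 0 < s → Tendsto (fun t : ℝ => t ^ s) (𝓝[>] 0) (𝓝 0) := by
    intro s hs
    have h1 : ContinuousAt (fun t : ℝ => t ^ s) 0 :=
      Real.continuousAt_rpow_const _ _ (Or.inr hs.le)
    have h2 : Tendsto (fun t : ℝ => t ^ s) (𝓝 0) (𝓝 ((0 : ℝ) ^ s)) := h1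
    rw [Real.zero_rpow hs.ne'] at h2
    exact h2.mono_left nhdsWithin_le_nhds
  have hUle : ∀ t, 0 < t → t ≤ Tc → meanEnergy E t ≤ N * (b * t ^ (γ + 1)) := by
    intro t ht htT
    refine hE.meanEnergy_le h0 hN ht (G := fun t => b * t ^ (γ + 1))
      (g := fun t => b * ((γ + 1) * t ^ γ)) (fun s hs hst => ?_)
      (fun s hs _ => (hderiv hs).const_mul b) (by simpa using (hlim hγ1).const_mul b)
    refine (hsp s hs (hst.trans htT)).trans (le_of_eq ?_)
    rw [Real.div_rpow hs.le hΔ.le, hb]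
    field_simp
  -- The temperature at which the integrated bound b T^(γ+1) on the energy density equals a/l. The
  -- true energy density takes this value at Tc, so T ≤ Tc.
  set T : ℝ := (a / l / b) ^ (1 / (γ + 1)) with hT
  have hTpos : 0 < T := by positivity
  have hTpow : b * T ^ (γ + 1) = a / l := by
    rw [hT, ← Real.rpow_mul (by positivity), one_div_mul_cancel hγ1.ne', Real.rpow_one]
    field_simp
  have hTTc : T ≤ Tc := by
    have h1 := hUle Tc hTc le_rfl
    rw [hU, ← hTpow] at h1
    have h2 : T ^ (γ + 1) ≤ Tc ^ (γ + 1) :=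
      le_of_mul_le_mul_left (le_of_mul_le_mul_left h1 hN) hbpos
    exact (Real.rpow_le_rpow_iff hTpos.le hTc.le hγ1).1 h2
  have hZ : Real.log (partitionFn E T) ≤
      Real.log (groundDegeneracy E) + N * (b / γ * T ^ (γ - 1 + 1)) := by
    refine hE.log_partitionFn_le h0 hTpos (L := fun t => b / γ * t ^ (γ - 1 + 1))
      (f := fun t => b / γ * ((γ - 1 + 1) * t ^ (γ - 1))) (fun t ht htT => ?_)
      (fun s hs _ => (hderiv hs).const_mul _)
      (by simpa using (hlim hγ).const_mul (b / γ))
    refine (hUle t ht (htT.trans hTTc)).trans (le_of_eq ?_)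
    have e1 : t ^ (γ + 1) = t ^ (γ - 1) * t ^ 2 := by
      rw [← Real.rpow_natCast t 2, ← Real.rpow_add ht]
      congr 1
      push_cast
      ring
    rw [e1]
    field_simp
    ring
  refine ⟨T, hTpos, ?_⟩
  have e1 : T ^ (γ - 1 + 1) = a / l / b / T := by
    rw [eq_div_iff hTpos.ne', eq_div_iff hbpos.ne', ← hTpow, Real.rpow_add_one hTpos.ne' γ]
    simp
    ring
  have e2 : a / l / T = a / (a / b) ^ (1 / (γ + 1)) * l ^ (1 / (γ + 1) - 1) := by
    have : a / l / b = a / b / l := by ring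
    rw [hT, this, Real.div_rpow (by positivity) hl0.le, Real.rpow_sub_one hl0.ne']
    field_simp
  -- At this T the bound on the logarithm of the partition function and the energy term are
  -- proportional, with ratio 1/γ.
  have e3 : N * (b / γ * (a / l / b / T)) + N * (a / l) / T = N * ((1 + 1 / γ) * (a / l / T)) := by
    field_simp
    ring
  rw [e1] at hZ
  rw [mul_assoc, ← e2, ← e3]
  linarith

end Thermodynamics


/-! ### Density operators as mixtures of vectors -/

section DensityOperators

variable {E Z : Type} [NormedAddCommGroup E] [InnerProductSpace ℂ E] [CompleteSpace E]

/-- The positive operator `∑_z |φ_z⟩⟨φ_z|`. -/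
noncomputable def mixture (φ : Z → E) : E →L[ℂ] E :=
  ∑' z, InnerProductSpace.rankOne ℂ (φ z) (φ z)

variable {φ : Z → E} (hφ : Summable fun z => ‖φ z‖ ^ 2)

include hφ

theorem hasSum_rankOne : HasSum (fun z => InnerProductSpace.rankOne ℂ (φ z) (φ z)) (mixture φ) := by
  refine Summable.hasSum (Summable.of_norm ?_)
  refine hφ.congr fun z => ?_
  rw [InnerProductSpace.norm_rankOne, sq]

theorem hasSum_mixture_apply (x : E) : HasSum (fun z => ⟪φ z, x⟫_ℂ • φ z) (mixture φ x) := by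
  have h := (ContinuousLinearMap.apply ℂ E x).hasSum (hasSum_rankOne hφ)
  simpa only [ContinuousLinearMap.apply_apply, InnerProductSpace.rankOne_apply] using h

theorem hasSum_inner_mixture (x y : E) :
    HasSum (fun z => ⟪φ z, x⟫_ℂ * ⟪y, φ z⟫_ℂ) ⟪y, mixture φ x⟫_ℂ := by
  simpa only [innerSL_apply_apply, inner_smul_right] using
    (innerSL ℂ y).hasSum (hasSum_mixture_apply hφ x)

theorem hasSum_norm_inner_sq (x : E) :
    HasSum (fun z => ‖⟪φ z, x⟫_ℂ‖ ^ 2) (⟪x, mixture φ x⟫_ℂ).re := by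
  have h := Complex.reCLM.hasSum (hasSum_inner_mixture hφ x x)
  refine h.congr_fun fun z => ?_
  rw [← inner_conj_symm x (φ z), Complex.mul_conj, Complex.normSq_eq_norm_sq]
  simp only [Complex.reCLM_apply, Complex.ofReal_re]

theorem mixture_form_nonneg (x : E) : 0 ≤ (⟪x, mixture φ x⟫_ℂ).re :=
  (hasSum_norm_inner_sq hφ x).nonneg fun _ => by positivity

theorem mixture_symm (x y : E) : ⟪mixture φ x, y⟫_ℂ = ⟪x, mixture φ y⟫_ℂ := by
  rw [← inner_conj_symm]
  have h1 := (hasSum_inner_mixture hφ x y).map (starRingEnd ℂ) Complex.continuous_conj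
  refine h1.unique ((hasSum_inner_mixture hφ y x).congr_fun fun z => ?_)
  simp [mul_comm]

/-- The rank-one series converges in operator norm, so the mixture is a norm limit of finite-rank
operators. -/
theorem isCompactOperator_mixture : IsCompactOperator (mixture φ) := by
  refine isCompactOperator_of_tendsto (hasSum_rankOne hφ) (Eventually.of_forall fun s => ?_)
  have : ∀ s : Finset Z, IsCompactOperator
      (∑ z ∈ s, InnerProductSpace.rankOne ℂ (φ z) (φ z) : E →L[ℂ] E) := by
    classical
    intro s
    induction s using Finset.induction_on with
    | empty => simpa using! (isCompactOperator_zero : IsCompactOperator (0 : E → E))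
    | insert a s ha ih =>
      rw [Finset.sum_insert ha]
      refine IsCompactOperator.add ?_ ih
      have h1 : IsCompactOperator (id : ℂ → ℂ) :=
        (isCompactOperator_id_iff_finiteDimensional (𝕜 := ℂ)).2 inferInstance
      have h2 := (h1.comp_clm (innerSL ℂ (φ a))).clm_comp
        (ContinuousLinearMap.toSpanSingleton ℂ (φ a))
      rw [InnerProductSpace.rankOne_def']
      exact h2
  exact this s

/-- Bessel's inequality for eigenvectors. -/
theorem sum_eigenvalue_mul_le {I : Type} [Fintype I] {v : I → E} (hv : Orthonormal ℂ v)
    {p : I → ℝ} (hp : ∀ i, mixture φ (v i) = (p i : ℂ) • v i) (x : E) :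
    ∑ i, p i * ‖⟪v i, x⟫_ℂ‖ ^ 2 ≤ (⟪x, mixture φ x⟫_ℂ).re := by
  -- The orthogonal projection of x onto the span of the eigenvectors. All cross terms with x equal
  -- t, so positivity of the form at x - x' is the claim.
  set x' : E := ∑ i, ⟪v i, x⟫_ℂ • v i with hx'
  set t : ℝ := ∑ i, p i * ‖⟪v i, x⟫_ℂ‖ ^ 2 with ht
  have h1 : mixture φ x' = ∑ i, (⟪v i, x⟫_ℂ * p i) • v i := by
    simp only [hx', map_sum, map_smul, hp, smul_smul]
  have h2 : ⟪x, mixture φ x'⟫_ℂ = t := by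
    rw [h1, inner_sum, ht]
    push_cast
    refine Finset.sum_congr rfl fun i _ => ?_
    rw [inner_smul_right, ← inner_conj_symm x (v i), mul_right_comm, Complex.mul_conj,
      Complex.normSq_eq_norm_sq]
    push_cast
    ring
  have h3 : ⟪x', mixture φ x'⟫_ℂ = t := by
    rw [← h2, h1, inner_sum, inner_sum]
    refine Finset.sum_congr rfl fun i _ => ?_
    rw [inner_smul_right, inner_smul_right]
    congr 1
    rw [hx', hv.inner_left_fintype, inner_conj_symm]
  have h4 : ⟪x', mixture φ x⟫_ℂ = t := by
    rw [← mixture_symm hφ, ← inner_conj_symm, h2, Complex.conj_ofReal]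
  have h5 := mixture_form_nonneg hφ (x - x')
  rw [map_sub, inner_sub_left, inner_sub_right, inner_sub_right, h2, h3, h4] at h5
  simp at h5
  linarith

end DensityOperators

theorem hasSum_norm_inner_sq_hilbertBasis {E κ : Type} [NormedAddCommGroup E]
    [InnerProductSpace ℂ E] (b : HilbertBasis κ ℂ E) (x : E) :
    HasSum (fun k => ‖⟪b k, x⟫_ℂ‖ ^ 2) (‖x‖ ^ 2) := by
  have h := Complex.reCLM.hasSum (b.hasSum_inner_mul_inner x x)
  have hn : Complex.reCLM ⟪x, x⟫_ℂ = ‖x‖ ^ 2 := by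
    rw [inner_self_eq_norm_sq_to_K]
    simp [← Complex.ofReal_pow]
  rw [hn] at h
  refine h.congr_fun fun k => ?_
  rw [← inner_conj_symm x (b k), mul_comm, Complex.mul_conj, Complex.normSq_eq_norm_sq]
  simp only [Complex.reCLM_apply, Complex.ofReal_re]

/-- This is log y ≤ y - 1 at y = q/p: the scalar form of nonnegativity of relative entropy. -/
theorem negMulLog_add_le {p q : ℝ} (hp : 0 ≤ p) (hq : 0 < q) :
    Real.negMulLog p + p ≤ q - p * Real.log q := by
  rcases hp.eq_or_lt with rfl | hp
  · simp [hq.le]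
  · have h := Real.log_le_sub_one_of_pos (div_pos hq hp)
    rw [Real.log_div hq.ne' hp.ne'] at h
    have : p * (Real.log q - Real.log p) ≤ p * (q / p - 1) := by gcongr
    rw [mul_sub, mul_sub, mul_div_cancel₀ _ hp.ne'] at this
    rw [Real.negMulLog]
    linarith

/-! ### The Gibbs variational principle for finitely many eigenvectors -/

section Gibbs

variable {E Z κ : Type} [NormedAddCommGroup E] [InnerProductSpace ℂ E] [CompleteSpace E]

/-- The Gibbs variational principle for a part of the spectrum of a density operator. -/
theorem sum_negMulLog_le {φ : Z → E} (hφ : Summable fun z => ‖φ z‖ ^ 2)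
    {I : Type} [Fintype I] {v : I → E} (hv : Orthonormal ℂ v)
    {p : I → ℝ} (hp : ∀ i, mixture φ (v i) = (p i : ℂ) • v i) (hp0 : ∀ i, 0 ≤ p i)
    (b : HilbertBasis κ ℂ E) {ε : κ → ℝ} (hε : Thermal ε) (h0 : ∃ j, ε j = 0) {U : ℝ}
    (hU : HasSum (fun k => ε k * (⟪b k, mixture φ (b k)⟫_ℂ).re) U) {T : ℝ} (hT : 0 < T) :
    ∑ i, Real.negMulLog (p i) ≤
      1 - ∑ i, p i + (∑ i, p i) * Real.log (partitionFn ε T) + U / T := by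
  have hZ := hε.partitionFn_pos h0 hT
  set Q := partitionFn ε T with hQ
  have hDk : ∀ i, HasSum (fun k => ‖⟪v i, b k⟫_ℂ‖ ^ 2) 1 := by
    intro i
    simpa [norm_inner_symm (v i), hv.1 i] using hasSum_norm_inner_sq_hilbertBasis b (v i)
  have hL : HasSum (fun k => ∑ i, ‖⟪v i, b k⟫_ℂ‖ ^ 2 *
      (Real.negMulLog (p i) + p i - p i * Real.log Q))
      (∑ i, (Real.negMulLog (p i) + p i - p i * Real.log Q)) := by
    refine hasSum_sum fun i _ => ?_
    simpa using (hDk i).mul_right (Real.negMulLog (p i) + p i - p i * Real.log Q)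
  have hR : HasSum (fun k => Real.exp (-ε k / T) / Q +
      ε k * (⟪b k, mixture φ (b k)⟫_ℂ).re / T) (1 + U / T) := by
    refine HasSum.add ?_ (hU.div_const T)
    have := (hε.summable T hT).hasSum.div_const Q
    rwa [show ∑' k, Real.exp (-ε k / T) = Q from rfl, div_self hZ.ne'] at this
  -- For each energy eigenvector the scalar inequality is used with q its Gibbs weight, averaged
  -- over i with weights |⟨v_i, b_k⟩|². Bessel's inequality bounds the q-term, and its weighted
  -- version bounds the energy term, where ε ≥ 0 is essential because the v_i need not be complete.
  have hle := hasSum_le (fun k => ?_) hL hR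
  · simp only [Finset.sum_add_distrib, Finset.sum_sub_distrib, ← Finset.sum_mul] at hle
    linarith
  · have hq : 0 < Real.exp (-ε k / T) / Q := by positivity
    have hlog : Real.log (Real.exp (-ε k / T) / Q) = -ε k / T - Real.log Q := by
      rw [Real.log_div (Real.exp_ne_zero _) hZ.ne', Real.log_exp]
    have h1 : ∀ i, ‖⟪v i, b k⟫_ℂ‖ ^ 2 * (Real.negMulLog (p i) + p i - p i * Real.log Q) ≤
        ‖⟪v i, b k⟫_ℂ‖ ^ 2 * (Real.exp (-ε k / T) / Q) +
          (p i * ‖⟪v i, b k⟫_ℂ‖ ^ 2) * (ε k / T) := by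
      intro i
      have := negMulLog_add_le (hp0 i) hq
      rw [hlog] at this
      have h2 : Real.negMulLog (p i) + p i - p i * Real.log Q ≤
        Real.exp (-ε k / T) / Q + p i * (ε k / T) := by
        have e : p i * (-ε k / T - Real.log Q) = -(p i * (ε k / T)) - p i * Real.log Q := by ring
        linarith
      calc _ ≤ ‖⟪v i, b k⟫_ℂ‖ ^ 2 * (Real.exp (-ε k / T) / Q + p i * (ε k / T)) := by gcongr
        _ = _ := by ring
    refine (Finset.sum_le_sum fun i _ => h1 i).trans ?_
    rw [Finset.sum_add_distrib, ← Finset.sum_mul, ← Finset.sum_mul]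
    have h3 : ∑ i, ‖⟪v i, b k⟫_ℂ‖ ^ 2 ≤ 1 := by
      have := hv.sum_inner_products_le (b k) (s := Finset.univ)
      simpa [b.orthonormal.1 k] using this
    have h4 := sum_eigenvalue_mul_le hφ hv hp (b k)
    have h5 : 0 ≤ ε k / T := div_nonneg (hε.nonneg k) hT.le
    calc _ ≤ 1 * (Real.exp (-ε k / T) / Q) + (⟪b k, mixture φ (b k)⟫_ℂ).re * (ε k / T) := by
          gcongr
      _ = _ := by ring

end Gibbs

/-! ### Spectral decomposition and entropy -/

section Eigenbasis

variable {E Z : Type} [NormedAddCommGroup E] [InnerProductSpace ℂ E] [CompleteSpace E]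

/-- A density operator has an orthonormal basis of eigenvectors, which computes the entropy. -/
theorem exists_eigenbasis {φ : Z → E} (hφ : HasSum (fun z => ‖φ z‖ ^ 2) 1) :
    ∃ (I : Type) (b : HilbertBasis I ℂ E) (p : I → ℝ),
      (∀ i, mixture φ (b i) = (p i : ℂ) • b i) ∧ (∀ i, 0 ≤ p i) ∧ HasSum p 1 ∧
      entropy (mixture φ) ≤ ∑' i, ENNReal.ofReal (Real.negMulLog (p i)) := by
  have hs := hφ.summable
  have hsym : (mixture φ : E →ₗ[ℂ] E).IsSymmetric := fun x y => mixture_symm hs x y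
  let W : ℝ → Submodule ℂ E := fun p => Module.End.eigenspace (mixture φ : E →ₗ[ℂ] E) (p : ℂ)
  have hWmem : ∀ (p : ℝ) (x : E), x ∈ W p ↔ mixture φ x = (p : ℂ) • x :=
    fun p x => Module.End.mem_eigenspace_iff
  have hWc : ∀ p, IsClosed (W p : Set E) := by
    intro p
    have : (W p : Set E) = {x | mixture φ x = (p : ℂ) • x} := by
      ext x; exact hWmem p x
    rw [this]
    exact isClosed_eq (mixture φ).continuous (continuous_const_smul _)
  have hWcomp : ∀ p, CompleteSpace (W p) := fun p => (hWc p).completeSpace_coe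
  -- Bases of the individual eigenspaces are joined into one basis. Real p suffice since the
  -- operator is symmetric, and completeness is the spectral theorem for compact operators.
  choose w c hc using fun p : ℝ => exists_hilbertBasis ℂ (W p)
  have hfam : OrthogonalFamily ℂ (fun p => W p) fun p => (W p).subtypeₗᵢ :=
    hsym.orthogonalFamily_eigenspaces.comp Complex.ofReal_injective
  have hon : Orthonormal ℂ fun i : (Σ p, w p) => ((c i.1 i.2 : W i.1) : E) :=
    hfam.orthonormal_sigma_orthonormal (v_family := fun p => c p) fun p => (c p).orthonormal
  have hperp : (Submodule.span ℂ
      (Set.range fun i : (Σ p, w p) => ((c i.1 i.2 : W i.1) : E)))ᗮ = ⊥ := by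
    rw [Submodule.eq_bot_iff]
    intro x hx
    rw [Submodule.mem_orthogonal] at hx
    have hx2 : ∀ p, ∀ y ∈ W p, ⟪y, x⟫_ℂ = 0 := by
      intro p y hy
      have h1 := (c p).hasSum_repr ⟨y, hy⟩
      have h2 := (innerSL ℂ x ∘L (W p).subtypeL).hasSum h1
      have h3 : ⟪x, y⟫_ℂ = 0 := by
        refine h2.unique ?_
        have : (fun i => (innerSL ℂ x ∘L (W p).subtypeL) ((c p).repr ⟨y, hy⟩ i • c p i)) =
            fun _ => 0 := by
          funext i
          have h4 := hx _ (Submodule.subset_span ⟨⟨p, i⟩, rfl⟩)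
          rw [map_smul]
          have h5 : (innerSL ℂ x ∘L (W p).subtypeL) (c p i) = 0 := by
            have : ⟪x, ((c p i : W p) : E)⟫_ℂ = 0 := by
              rw [← inner_conj_symm, h4, map_zero]
            exact this
          rw [h5, smul_zero]
        rw [this]
        exact hasSum_zero
      rw [← inner_conj_symm, h3, map_zero]
    have hspec := ContinuousLinearMap.orthogonalComplement_iSup_eigenspaces_eq_bot
      (isCompactOperator_mixture hs) hsym
    have hmem : x ∈ (⨆ μ, Module.End.eigenspace (mixture φ : Module.End ℂ E) μ)ᗮ := by
      rw [← Submodule.iInf_orthogonal, Submodule.mem_iInf]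
      intro μ
      rw [Submodule.mem_orthogonal]
      intro y hy
      by_cases hy0 : y = 0
      · simp [hy0]
      · have hμ : (starRingEnd ℂ) μ = μ := hsym.conj_eigenvalue_eq_self
          (Module.End.hasEigenvalue_of_hasEigenvector ⟨hy, hy0⟩)
        have hμ' : ((μ.re : ℝ) : ℂ) = μ := Complex.conj_eq_iff_re.1 hμ
        refine hx2 μ.re y ?_
        change y ∈ Module.End.eigenspace _ _
        rwa [hμ']
    rw [hspec] at hmem
    exact (Submodule.mem_bot ℂ).1 hmem
  let b : HilbertBasis (Σ p, w p) ℂ E := HilbertBasis.mkOfOrthogonalEqBot hon hperp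
  have hb : ∀ i, b i = ((c i.1 i.2 : W i.1) : E) := fun i => by
    rw [HilbertBasis.coe_mkOfOrthogonalEqBot]
  have heig : ∀ i, mixture φ (b i) = (i.1 : ℂ) • b i := by
    intro i
    rw [hb]
    exact (hWmem i.1 _).1 (c i.1 i.2).2
  have hform : ∀ i, (⟪b i, mixture φ (b i)⟫_ℂ).re = i.1 := by
    intro i
    rw [heig, inner_smul_right, inner_self_eq_norm_sq_to_K, b.orthonormal.1 i]
    simp
  have hnonneg : ∀ i : (Σ p, w p), 0 ≤ i.1 := fun i => by
    rw [← hform]; exact mixture_form_nonneg hs _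
  refine ⟨Σ p, w p, b, fun i => i.1, heig, hnonneg, ?_, ?_⟩
  -- The trace is computed in two ways: Parseval for each φ z, and the eigenvalue as a sum over z,
  -- exchanged by Tonelli.
  · have hz : ∀ z, HasSum (fun i => ‖⟪b i, φ z⟫_ℂ‖ ^ 2) (‖φ z‖ ^ 2) :=
      fun z => hasSum_norm_inner_sq_hilbertBasis b (φ z)
    have hsum : Summable fun q : Z × (Σ p, w p) => ‖⟪b q.2, φ q.1⟫_ℂ‖ ^ 2 := by
      rw [summable_prod_of_nonneg fun _ => by positivity]
      exact ⟨fun z => (hz z).summable, by simpa only [(hz _).tsum_eq] using hs⟩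
    have h1 : ∑' q : Z × (Σ p, w p), ‖⟪b q.2, φ q.1⟫_ℂ‖ ^ 2 = 1 :=
      (hsum.hasSum.prod_fiberwise hz).unique hφ
    have h2 : HasSum (fun q : (Σ p, w p) × Z => ‖⟪b q.1, φ q.2⟫_ℂ‖ ^ 2) 1 := by
      rw [← h1]
      exact (Equiv.prodComm _ _).hasSum_iff.2 hsum.hasSum
    refine h2.prod_fiberwise fun i => ?_
    have := hasSum_norm_inner_sq hs (b i)
    rw [hform] at this
    simpa only [norm_inner_symm] using this
  · rw [entropy, ENNReal.tsum_sigma' fun i : (Σ p, w p) => ENNReal.ofReal (Real.negMulLog i.1)]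
    refine ENNReal.tsum_le_tsum fun p => ?_
    change _ ≤ ∑' _ : w p, ENNReal.ofReal (Real.negMulLog p)
    rw [ENNReal.tsum_const]
    gcongr
    change ((Module.finrank ℂ (W p) : ℕ) : ℝ≥0∞) ≤ _
    -- For an infinite index set the cardinality on the right is ⊤, so the bound is trivial.
    rcases finite_or_infinite (w p) with hfin | hinf
    · have : Fintype (w p) := Fintype.ofFinite _
      rw [Module.finrank_eq_card_basis (c p).toOrthonormalBasis.toBasis,
        ENat.card_eq_coe_fintype_card]
      rfl
    · simp

end Eigenbasis


/-! ### Product vectors and products of density operators -/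

section Products

/-- Unconditional summability of products of functions on a finite product. -/
def PiProdSummable (𝕜 : Type) [NormedField 𝕜] (M : Type) [Fintype M] : Prop :=
  ∀ {X : Type} {f : M → X → 𝕜}, (∀ m, Summable fun x => ‖f m x‖) →
    (Summable fun w : M → X => ‖∏ m, f m (w m)‖) ∧
      HasSum (fun w : M → X => ∏ m, f m (w m)) (∏ m, ∑' x, f m x)

theorem PiProdSummable.of_equiv {𝕜 : Type} [NormedField 𝕜] {α β : Type} [Fintype α] [Fintype β]
    (e : α ≃ β) (ih : PiProdSummable 𝕜 α) : PiProdSummable 𝕜 β := by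
  intro X f hf
  obtain ⟨h1, h2⟩ := ih (f := fun a => f (e a)) fun a => hf (e a)
  have hE : ∀ w : β → X, ∏ m, f m (w m) =
      ∏ a, f (e a) ((Equiv.arrowCongr e.symm (Equiv.refl X)) w a) := by
    intro w
    rw [← Equiv.prod_comp e]
    simp
  constructor
  · simp only [hE]
    exact ((Equiv.arrowCongr e.symm (Equiv.refl X)).summable_iff
      (f := fun w : α → X => ‖∏ a, f (e a) (w a)‖)).2 h1
  · simp only [hE]
    rw [← Equiv.prod_comp e]
    exact ((Equiv.arrowCongr e.symm (Equiv.refl X)).hasSum_iff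
      (f := fun w : α → X => ∏ a, f (e a) (w a))).2 h2

theorem hasSum_mul_of_equiv {𝕜 : Type} [NormedField 𝕜] [CompleteSpace 𝕜] {W X Y : Type}
    (e : W ≃ X × Y) {f : X → 𝕜} {k : Y → 𝕜} {F : W → 𝕜} {b : 𝕜}
    (hF : ∀ w, F w = f (e w).1 * k (e w).2)
    (hf : Summable fun x => ‖f x‖) (hk : Summable fun y => ‖k y‖) (hb : HasSum k b) :
    (Summable fun w => ‖F w‖) ∧ HasSum F ((∑' x, f x) * b) := by
  have h1 : Summable fun q : X × Y => ‖f q.1 * k q.2‖ := hf.mul_norm hk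
  have h2 : HasSum (fun q : X × Y => f q.1 * k q.2) ((∑' x, f x) * b) := by
    rw [← hb.tsum_eq, tsum_mul_tsum_of_summable_norm hf hk]
    exact h1.of_norm.hasSum
  constructor
  · simp only [hF]
    exact (e.summable_iff (f := fun q : X × Y => ‖f q.1 * k q.2‖)).2 h1
  · have : F = (fun q : X × Y => f q.1 * k q.2) ∘ e := funext hF
    rw [this]
    exact e.hasSum_iff.2 h2

theorem PiProdSummable.option {𝕜 : Type} [NormedField 𝕜] [CompleteSpace 𝕜] {α : Type} [Fintype α]
    (ih : PiProdSummable 𝕜 α) : PiProdSummable 𝕜 (Option α) := by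
  intro X f hf
  obtain ⟨h1, h2⟩ := ih (X := X) (f := fun a => f (some a)) fun a => hf (some a)
  rw [Fintype.prod_option]
  refine hasSum_mul_of_equiv (Equiv.piOptionEquivProd (β := fun _ : Option α => X))
    (f := f none) (k := fun w : α → X => ∏ a, f (some a) (w a)) (fun w => ?_) (hf none) h1 h2
  rw [Fintype.prod_option]
  rfl

theorem PiProdSummable.empty {𝕜 : Type} [NormedField 𝕜] : PiProdSummable 𝕜 PEmpty.{1} := by
  intro X f _
  simp only [Finset.univ_eq_empty, Finset.prod_empty]
  have h (c : 𝕜) : HasSum (fun _ : PEmpty.{1} → X => c) c := by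
    convert hasSum_fintype (fun _ : PEmpty.{1} → X => c)
    simp
  exact ⟨(hasSum_fintype _).summable, h 1⟩

/-- Induction on the finite index type, adding one factor at a time through `Option` with the
absolutely convergent product of two series. Norms, inner products and mixtures of product vectors
are all computed by this distributivity. -/
theorem hasSum_prod_pi {𝕜 : Type} [NormedField 𝕜] [CompleteSpace 𝕜] (M : Type) [Fintype M]
    {X : Type} {f : M → X → 𝕜} (hf : ∀ m, Summable fun x => ‖f m x‖) :
    (Summable fun w : M → X => ‖∏ m, f m (w m)‖) ∧
      HasSum (fun w : M → X => ∏ m, f m (w m)) (∏ m, ∑' x, f m x) := by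
  have h : PiProdSummable 𝕜 M := by
    refine Fintype.induction_empty_option (P := fun M _ => PiProdSummable 𝕜 M)
      ?_ ?_ ?_ M
    · intro α β _ e ih
      exact @PiProdSummable.of_equiv 𝕜 _ α β (Fintype.ofEquiv β e.symm) _ e ih
    · exact PiProdSummable.empty
    · intro α _ ih
      exact ih.option
  exact h hf

variable {M X Y : Type} [Fintype M]

theorem summable_norm_sq (χ : L2 X) : Summable fun x => ‖χ x‖ ^ 2 := by
  have := (memℓp_gen_iff (by norm_num)).1 (lp.memℓp χ)
  simpa using this

theorem memlp_two {f : X → ℂ} (hf : Summable fun x => ‖f x‖ ^ 2) :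
    Memℓp f 2 := by
  rw [memℓp_gen_iff (by norm_num)]
  simpa using hf

theorem hasSum_inner (χ χ' : L2 X) : HasSum (fun x => star (χ x) * χ' x) ⟪χ, χ'⟫_ℂ := by
  have := lp.hasSum_inner (𝕜 := ℂ) χ χ'
  simpa [mul_comm] using this

theorem summable_norm_inner (χ χ' : L2 X) : Summable fun x => ‖star (χ x) * χ' x‖ := by
  refine Summable.of_nonneg_of_le (fun _ => norm_nonneg _) (fun x => ?_)
    ((summable_norm_sq χ).add (summable_norm_sq χ'))
  rw [norm_mul, norm_star]
  nlinarith [sq_nonneg (‖χ x‖ - ‖χ' x‖), sq_nonneg (‖χ x‖), sq_nonneg (‖χ' x‖)]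

theorem hasSum_norm_sq (χ : L2 X) : HasSum (fun x => ‖χ x‖ ^ 2) (‖χ‖ ^ 2) := by
  have h := lp.hasSum_norm (p := 2) (by norm_num) χ
  simpa using h

/-- The product vector with factors `χ m`, the configurations `Y` being identified with families
of configurations of the factors. -/
noncomputable def prodVec (e : Y ≃ (M → X)) (χ : M → L2 X) : L2 Y :=
  ⟨fun y => ∏ m, χ m (e y m), memlp_two (by
    have h := (hasSum_prod_pi M (f := fun m x => ‖χ m x‖ ^ 2)
      (fun m => by simpa using summable_norm_sq (χ m))).2.summable
    have h2 := e.summable_iff.2 h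
    refine h2.congr fun y => ?_
    simp [Finset.prod_pow])⟩

theorem prodVec_apply (e : Y ≃ (M → X)) (χ : M → L2 X) (y : Y) :
    prodVec e χ y = ∏ m, χ m (e y m) := rfl

theorem inner_prodVec (e : Y ≃ (M → X)) (χ χ' : M → L2 X) :
    ⟪prodVec e χ, prodVec e χ'⟫_ℂ = ∏ m, ⟪χ m, χ' m⟫_ℂ := by
  have h := (hasSum_prod_pi M (f := fun m x => star (χ m x) * χ' m x)
      (fun m => summable_norm_inner (χ m) (χ' m))).2
  simp only [(hasSum_inner _ _).tsum_eq] at h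
  refine (hasSum_inner _ _).unique ((e.hasSum_iff.2 h).congr_fun fun y => ?_)
  simp [prodVec_apply, Finset.prod_mul_distrib]

theorem norm_prodVec (e : Y ≃ (M → X)) (χ : M → L2 X) : ‖prodVec e χ‖ = ∏ m, ‖χ m‖ := by
  have h := inner_prodVec e χ χ
  simp only [inner_self_eq_norm_sq_to_K] at h
  have h2 : ‖prodVec e χ‖ ^ 2 = (∏ m, ‖χ m‖) ^ 2 := by
    rw [← Finset.prod_pow]
    have h3 : ((‖prodVec e χ‖ ^ 2 : ℝ) : ℂ) = ((∏ m, ‖χ m‖ ^ 2 : ℝ) : ℂ) := by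
      push_cast
      exact h
    exact_mod_cast h3
  exact (sq_eq_sq₀ (norm_nonneg _) (Finset.prod_nonneg fun _ _ => norm_nonneg _)).1 h2

variable {Z : Type}

theorem hasSum_norm_prodVec_sq (e : Y ≃ (M → X)) {φ : Z → L2 X}
    (hφ : HasSum (fun z => ‖φ z‖ ^ 2) 1) :
    HasSum (fun z : M → Z => ‖prodVec e fun m => φ (z m)‖ ^ 2) 1 := by
  have h := (hasSum_prod_pi M (f := fun (_ : M) z => ‖φ z‖ ^ 2)
    (fun m => by simpa using hφ.summable)).2
  simp only [hφ.tsum_eq, Finset.prod_const_one] at h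
  simpa only [norm_prodVec, Finset.prod_pow] using h

theorem hasSum_apply {v : Z → L2 X} {u : L2 X} (h : HasSum v u) (x : X) :
    HasSum (fun z => v z x) (u x) :=
  (lp.evalCLM ℂ (fun _ : X => ℂ) 2 x).hasSum h

/-- The mixture of product vectors is the tensor power of the mixture. This is only needed on
product eigenvectors, where it is checked coordinatewise by factorizing the sum over z. -/
theorem mixture_prodVec (e : Y ≃ (M → X)) {φ : Z → L2 X}
    (hφ : HasSum (fun z => ‖φ z‖ ^ 2) 1) {v : M → L2 X} {p : M → ℝ}
    (hv : ∀ m, mixture φ (v m) = (p m : ℂ) • v m) :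
    mixture (fun z : M → Z => prodVec e fun m => φ (z m)) (prodVec e v) =
      ((∏ m, p m : ℝ) : ℂ) • prodVec e v := by
  ext y
  have h1 := hasSum_apply (hasSum_mixture_apply (hasSum_norm_prodVec_sq e hφ).summable
    (prodVec e v)) y
  have h2 : ∀ m, HasSum (fun z => ⟪φ z, v m⟫_ℂ * φ z (e y m)) (p m * v m (e y m)) := by
    intro m
    have := hasSum_apply (hasSum_mixture_apply hφ.summable (v m)) (e y m)
    rw [hv] at this
    exact this
  have h3 : ∀ m, Summable fun z => ‖⟪φ z, v m⟫_ℂ * φ z (e y m)‖ := by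
    intro m
    refine Summable.of_nonneg_of_le (fun _ => norm_nonneg _) (fun z => ?_)
      (hφ.summable.mul_left ‖v m‖)
    rw [norm_mul]
    have h4 : ‖φ z (e y m)‖ ≤ ‖φ z‖ := lp.norm_apply_le_norm (by norm_num) _ _
    have h5 : ‖⟪φ z, v m⟫_ℂ‖ ≤ ‖φ z‖ * ‖v m‖ := norm_inner_le_norm _ _
    calc _ ≤ (‖φ z‖ * ‖v m‖) * ‖φ z‖ := by gcongr
      _ = _ := by ring
  have h4 := (hasSum_prod_pi M h3).2
  simp only [(h2 _).tsum_eq] at h4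
  refine h1.unique ?_
  have h5 : (((∏ m, p m : ℝ) : ℂ) • prodVec e v : L2 Y) y = ∏ m, (p m * v m (e y m)) := by
    rw [lp.coeFn_smul, Pi.smul_apply, prodVec_apply, Finset.prod_mul_distrib, smul_eq_mul]
    push_cast
    rfl
  rw [h5]
  refine h4.congr_fun fun z => ?_
  rw [lp.coeFn_smul, Pi.smul_apply, inner_prodVec, prodVec_apply, smul_eq_mul,
    Finset.prod_mul_distrib]

theorem orthonormal_prodVec (e : Y ≃ (M → X)) {I : Type} {v : I → L2 X} (hv : Orthonormal ℂ v) :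
    Orthonormal ℂ fun i : M → I => prodVec e fun m => v (i m) := by
  classical
  rw [orthonormal_iff_ite]
  intro i j
  rw [inner_prodVec]
  simp only [orthonormal_iff_ite.1 hv]
  rw [Finset.prod_ite_zero]
  simp [funext_iff]

end Products

/-- The Leibniz rule for -x log x. It needs no positivity: if a factor vanishes, every summand
contains either that factor or its `negMulLog`, which is zero. -/
theorem negMulLog_prod {M : Type} [Fintype M] [DecidableEq M] (f : M → ℝ) :
    Real.negMulLog (∏ m, f m) = ∑ m, Real.negMulLog (f m) * ∏ m' ∈ Finset.univ.erase m, f m' := by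
  by_cases h : ∀ m, f m ≠ 0
  · rw [Real.negMulLog, Real.log_prod (fun m _ => h m), Finset.mul_sum]
    refine Finset.sum_congr rfl fun m _ => ?_
    rw [← Finset.mul_prod_erase _ _ (Finset.mem_univ m), Real.negMulLog]
    ring
  · push Not at h
    obtain ⟨m₀, hm₀⟩ := h
    rw [Finset.prod_eq_zero (Finset.mem_univ m₀) hm₀, Real.negMulLog_zero]
    refine (Finset.sum_eq_zero fun m _ => ?_).symm
    by_cases hm : m = m₀
    · rw [hm, hm₀, Real.negMulLog_zero, zero_mul]
    · rw [Finset.prod_eq_zero (Finset.mem_erase.2 ⟨Ne.symm hm, Finset.mem_univ _⟩) hm₀, mul_zero]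

/-- The entropy of a product distribution. -/
theorem sum_negMulLog_prod {M I : Type} [Fintype M] [DecidableEq M] [Fintype I] (p : I → ℝ) :
    ∑ i : M → I, Real.negMulLog (∏ m, p (i m)) =
      Fintype.card M * ((∑ i, Real.negMulLog (p i)) * (∑ i, p i) ^ (Fintype.card M - 1)) := by
  simp only [negMulLog_prod]
  rw [Finset.sum_comm]
  have h : ∀ m : M, ∑ i : M → I, Real.negMulLog (p (i m)) *
      ∏ m' ∈ Finset.univ.erase m, p (i m') =
      (∑ i, Real.negMulLog (p i)) * (∑ i, p i) ^ (Fintype.card M - 1) := by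
    intro m
    have h1 := Finset.prod_univ_sum (fun _ : M => (Finset.univ : Finset I))
      (fun m' i => if m' = m then Real.negMulLog (p i) else p i)
    rw [Fintype.piFinset_univ] at h1
    rw [← Finset.mul_prod_erase _ _ (Finset.mem_univ m)] at h1
    rw [Finset.prod_congr rfl (g := fun _ => ∑ i, p i) (fun m' hm' => by
      simp [(Finset.mem_erase.1 hm').1])] at h1
    rw [Finset.prod_const, Finset.card_erase_of_mem (Finset.mem_univ m), Finset.card_univ] at h1
    simp only [if_true] at h1
    rw [h1]
    refine Finset.sum_congr rfl fun i _ => ?_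
    rw [← Finset.mul_prod_erase _ _ (Finset.mem_univ m)]
    simp only [if_true]
    congr 1
    exact Finset.prod_congr rfl fun m' hm' => by simp [(Finset.mem_erase.1 hm').1]
  simp [h]

/-! ### Entropy bound from the tensor power -/

section TensorPower

variable {M X Y Z κ : Type} [Fintype M] [Nonempty M]

/-- The Gibbs variational principle for a tensor power of a density operator. -/
theorem entropy_le_of_tensorPower (e : Y ≃ (M → X)) {φ : Z → L2 X}
    (hφ : HasSum (fun z => ‖φ z‖ ^ 2) 1) (b : HilbertBasis κ ℂ (L2 Y)) {ε : κ → ℝ}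
    (hε : Thermal ε) (h0 : ∃ j, ε j = 0) {U : ℝ}
    (hU : HasSum (fun k => ε k *
      (⟪b k, mixture (fun z : M → Z => prodVec e fun m => φ (z m)) (b k)⟫_ℂ).re) U)
    {T : ℝ} (hT : 0 < T) :
    entropy (mixture φ) ≤ ENNReal.ofReal
      ((Real.log (partitionFn ε T) + U / T) / Fintype.card M) := by
  obtain ⟨I, c, p, hp, hp0, hp1, hent⟩ := exists_eigenbasis hφ
  classical
  refine hent.trans ?_
  rw [ENNReal.tsum_eq_iSup_sum]
  refine iSup_le fun F₀ => ?_
  have hple : ∀ i, p i ≤ 1 := fun i => by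
    have := hp1.summable.le_tsum i (fun j _ => hp0 j)
    rwa [hp1.tsum_eq] at this
  have hneg : ∀ i, 0 ≤ Real.negMulLog (p i) := fun i => Real.negMulLog_nonneg (hp0 i) (hple i)
  rw [← ENNReal.ofReal_sum_of_nonneg fun i _ => hneg i]
  refine ENNReal.ofReal_le_ofReal ?_
  rw [le_div_iff₀ (by exact_mod_cast Fintype.card_pos)]
  set L := Real.log (partitionFn ε T) with hL
  set n := Fintype.card M with hn
  -- Truncating each factor to F gives finitely many product eigenvectors, of total mass (∑ p)^n.
  -- The entropy is additive only up to the mass of the other n - 1 factors.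
  have key : ∀ F : Finset I, n * ((∑ i ∈ F, Real.negMulLog (p i)) * (∑ i ∈ F, p i) ^ (n - 1)) ≤
      1 - (∑ i ∈ F, p i) ^ n + (∑ i ∈ F, p i) ^ n * L + U / T := by
    intro F
    have hv : Orthonormal ℂ fun i : F => c i := c.orthonormal.comp _ Subtype.val_injective
    have h := sum_negMulLog_le (hasSum_norm_prodVec_sq e hφ).summable (orthonormal_prodVec e hv)
      (p := fun i : M → F => ∏ m, p (i m)) (fun i => mixture_prodVec e hφ fun m => hp (i m))
      (fun i => Finset.prod_nonneg fun m _ => hp0 _) b hε h0 hU hT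
    rw [sum_negMulLog_prod (fun i : F => p i)] at h
    have h2 : ∑ i : M → F, ∏ m, p (i m) = (∑ i : F, p i) ^ n := by
      have := Finset.prod_univ_sum (fun _ : M => (Finset.univ : Finset F)) (fun _ i => p i)
      rw [Fintype.piFinset_univ, Finset.prod_const, Finset.card_univ] at this
      exact this.symm
    rw [h2, Finset.sum_coe_sort F p, Finset.sum_coe_sort F fun i => Real.negMulLog (p i)] at h
    exact h
  have hP : Tendsto (fun F : Finset I => ∑ i ∈ F, p i) atTop (𝓝 1) := hp1
  -- The entropy sum stays on F₀ while the mass is taken along growing F. In this way the limit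
  -- exists before the entropy is known to be finite.
  have hlim1 : Tendsto (fun F : Finset I => n * ((∑ i ∈ F₀, Real.negMulLog (p i)) *
      (∑ i ∈ F, p i) ^ (n - 1))) atTop (𝓝 (n * ((∑ i ∈ F₀, Real.negMulLog (p i)) * 1 ^ (n - 1)))) :=
    ((hP.pow _).const_mul _).const_mul _
  have hlim2 : Tendsto (fun F : Finset I => 1 - (∑ i ∈ F, p i) ^ n + (∑ i ∈ F, p i) ^ n * L + U / T)
      atTop (𝓝 (1 - 1 ^ n + 1 ^ n * L + U / T)) :=
    (((hP.pow _).const_sub 1).add ((hP.pow _).mul_const L)).add_const _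
  have := le_of_tendsto_of_tendsto hlim1 hlim2 (by
    filter_upwards [eventually_ge_atTop F₀] with F hF
    refine le_trans ?_ (key F)
    have h1 : ∑ i ∈ F₀, Real.negMulLog (p i) ≤ ∑ i ∈ F, Real.negMulLog (p i) :=
      Finset.sum_le_sum_of_subset_of_nonneg hF fun i _ _ => hneg i
    have h2 : 0 ≤ ∑ i ∈ F, p i := Finset.sum_nonneg fun i _ => hp0 i
    gcongr)
  simp only [one_pow, mul_one, one_mul, sub_self, zero_add] at this
  linarith

end TensorPower


/-! ### Graphs and expectation values of unbounded operators -/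

section Graphs

variable {E : Type} [AddCommGroup E] [Module ℂ E]

theorem mem_graph_add {X Y : UOp E} {x a b : E} (ha : (x, a) ∈ X.graph) (hb : (x, b) ∈ Y.graph) :
    (x, a + b) ∈ (X + Y).graph := by
  rw [LinearPMap.mem_graph_iff] at ha hb ⊢
  obtain ⟨u, hu, hu'⟩ := ha
  obtain ⟨v, hv, hv'⟩ := hb
  obtain ⟨u, hud⟩ := u
  obtain ⟨v, hvd⟩ := v
  simp only at hu hv hu' hv'
  subst hu
  subst hv
  exact ⟨⟨v, hud, hvd⟩, rfl, by rw [← hu', ← hv']; rfl⟩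

theorem mem_graph_sum {J : Type} {X : J → UOp E} {x : E} {a : J → E} (s : Finset J)
    (h : ∀ j, (x, a j) ∈ (X j).graph) : (x, ∑ j ∈ s, a j) ∈ (∑ j ∈ s, X j).graph := by
  classical
  induction s using Finset.induction_on with
  | empty =>
    rw [Finset.sum_empty, Finset.sum_empty, LinearPMap.mem_graph_iff]
    exact ⟨⟨x, trivial⟩, rfl, rfl⟩
  | insert j s hj ih =>
    rw [Finset.sum_insert hj, Finset.sum_insert hj]
    exact mem_graph_add (h j) ih

theorem mem_domain_of_sum {J : Type} {X : J → UOp E} {x : E} {s : Finset J}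
    (h : x ∈ (∑ j ∈ s, X j).domain) : ∀ j ∈ s, x ∈ (X j).domain := by
  classical
  induction s using Finset.induction_on with
  | empty => simp
  | insert j s hj ih =>
    rw [Finset.sum_insert hj, LinearPMap.add_domain] at h
    intro j' hj'
    rcases Finset.mem_insert.1 hj' with rfl | hj'
    · exact h.1
    · exact ih h.2 j' hj'

end Graphs

section Energy

variable {E : Type} [NormedAddCommGroup E] [InnerProductSpace ℂ E]

theorem expect_eq {X : UOp E} {x y : E} (h : (x, y) ∈ X.graph) : expect X x = ⟪x, y⟫_ℂ := by
  have hd : x ∈ X.domain := LinearPMap.mem_domain_of_mem_graph h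
  rw [expect, dif_pos hd, (LinearPMap.image_iff hd).2 h]

theorem mem_graph_centered {X : UOp E} {x y ψ : E} (h : (x, y) ∈ X.graph) :
    (x, y - expect X ψ • x) ∈ (centered X ψ).graph := by
  rw [LinearPMap.mem_graph_iff] at h ⊢
  obtain ⟨u, hu, hu'⟩ := h
  refine ⟨u, hu, ?_⟩
  change -(expect X ψ • (u : E)) + X u = y - expect X ψ • x
  rw [hu', hu]
  exact neg_add_eq_sub _ _

/-- The covariance is the expectation of the product minus the product of the expectations. -/
theorem covAdj_eq {X Y : UOp E} {ψ x y w : E} (hψ : ‖ψ‖ = 1) (hx : (ψ, x) ∈ X.graph)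
    (hy : (ψ, y) ∈ Y.graph) (hw : (y, w) ∈ X.graph) :
    covAdj X Y ψ = ⟪ψ, w⟫_ℂ - ⟪ψ, x⟫_ℂ * ⟪ψ, y⟫_ℂ := by
  have hψ2 : ⟪ψ, ψ⟫_ℂ = 1 := by rw [inner_self_eq_norm_sq_to_K, hψ]; simp
  have h1 := mem_graph_centered (ψ := ψ) hy
  have h2 : (y - expect Y ψ • ψ, w - expect Y ψ • x) ∈ X.graph :=
    X.graph.sub_mem hw (X.graph.smul_mem _ hx)
  have h3 := mem_graph_centered (ψ := ψ) h2
  have h4 : (ψ, w - expect Y ψ • x - expect X ψ • (y - expect Y ψ • ψ)) ∈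
      (mulOp (centered X ψ) (centered Y ψ)).graph := by
    rw [mulOp_graph]
    exact ⟨_, h1, h3⟩
  rw [covAdj, expect_eq h4, expect_eq hx, expect_eq hy]
  simp only [inner_sub_right, inner_smul_right, hψ2]
  ring

variable [CompleteSpace E] {Z κ : Type}

theorem inner_graph_symm {H : UOp E} (hH : IsSelfAdjoint H) {x x' y y' : E}
    (hx : (x, x') ∈ H.graph) (hy : (y, y') ∈ H.graph) : ⟪x', y⟫_ℂ = ⟪x, y'⟫_ℂ := by
  have h := LinearPMap.adjoint_isFormalAdjoint hH.dense_domain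
  rw [LinearPMap.isSelfAdjoint_def.1 hH] at h
  rw [LinearPMap.mem_graph_iff] at hx hy
  obtain ⟨u, hu, hu'⟩ := hx
  obtain ⟨v, hv, hv'⟩ := hy
  have := h v u
  simp only at hu hu' hv hv'
  rw [hu, hu', hv, hv'] at this
  rw [← inner_conj_symm, ← inner_conj_symm x, this]

/-- The energy of a mixture of vectors in the domain of the Hamiltonian. -/
theorem hasSum_energy {H : UOp E} (hH : IsSelfAdjoint H) (σ : EigenData H κ)
    (hσ : ∀ k, 0 ≤ σ.energy k) {φ η : Z → E} (hφ : Summable fun z => ‖φ z‖ ^ 2)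
    (hη : ∀ z, (φ z, η z) ∈ H.graph) {U : ℝ} (hU : HasSum (fun z => (⟪φ z, η z⟫_ℂ).re) U) :
    HasSum (fun k => σ.energy k * (⟪σ.basis k, mixture φ (σ.basis k)⟫_ℂ).re) U := by
  have h1 : ∀ z, HasSum (fun k => σ.energy k * ‖⟪φ z, σ.basis k⟫_ℂ‖ ^ 2) (⟪φ z, η z⟫_ℂ).re := by
    intro z
    have h := Complex.reCLM.hasSum (σ.basis.hasSum_inner_mul_inner (φ z) (η z))
    refine h.congr_fun fun k => ?_
    -- Symmetry moves H from φ z to the eigenvector, so Parseval for ⟨φ z, H φ z⟩ becomes a series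
    -- of nonnegative terms. Tonelli then exchanges the sums over z and k.
    have h2 := inner_graph_symm hH (σ.mem_graph k) (hη z)
    rw [← h2, inner_smul_left, Complex.conj_ofReal, ← inner_conj_symm (σ.basis k) (φ z),
      mul_left_comm, Complex.mul_conj, Complex.normSq_eq_norm_sq, ← Complex.ofReal_mul]
    rfl
  have hnn : ∀ q : Z × κ, 0 ≤ σ.energy q.2 * ‖⟪φ q.1, σ.basis q.2⟫_ℂ‖ ^ 2 :=
    fun q => mul_nonneg (hσ _) (by positivity)
  have hsum : Summable fun q : Z × κ => σ.energy q.2 * ‖⟪φ q.1, σ.basis q.2⟫_ℂ‖ ^ 2 := by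
    rw [summable_prod_of_nonneg hnn]
    exact ⟨fun z => (h1 z).summable, by simpa only [(h1 _).tsum_eq] using hU.summable⟩
  have h2 : ∑' q : Z × κ, σ.energy q.2 * ‖⟪φ q.1, σ.basis q.2⟫_ℂ‖ ^ 2 = U :=
    (hsum.hasSum.prod_fiberwise h1).unique hU
  have h3 : HasSum (fun q : κ × Z => σ.energy q.1 * ‖⟪φ q.2, σ.basis q.1⟫_ℂ‖ ^ 2) U := by
    rw [← h2]
    exact ((Equiv.prodComm κ Z).hasSum_iff
      (f := fun q : Z × κ => σ.energy q.2 * ‖⟪φ q.1, σ.basis q.2⟫_ℂ‖ ^ 2)).2 hsum.hasSum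
  exact h3.prod_fiberwise fun k => (hasSum_norm_inner_sq hφ (σ.basis k)).mul_left _

end Energy

/-! ### Slices of vectors and splittings of configurations -/

section Slices

variable {X Z W : Type}

/-- The slices of a vector with respect to a splitting of the configurations. -/
def sliceAt (e : X × Z ≃ W) (z : Z) : L2 W →ₗ[ℂ] L2 X :=
  pull (fun x => e (x, z)) fun _ _ h => (Prod.ext_iff.1 (e.injective h)).1

theorem sliceAt_apply (e : X × Z ≃ W) (z : Z) (χ : L2 W) (x : X) :
    sliceAt e z χ x = χ (e (x, z)) := rfl

theorem hasSum_inner_sliceAt (e : X × Z ≃ W) (χ χ' : L2 W) :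
    HasSum (fun z => ⟪sliceAt e z χ, sliceAt e z χ'⟫_ℂ) ⟪χ, χ'⟫_ℂ := by
  have h1 := (((Equiv.prodComm Z X).trans e).hasSum_iff).2 (hasSum_inner χ χ')
  exact h1.prod_fiberwise fun z => hasSum_inner (sliceAt e z χ) (sliceAt e z χ')

theorem hasSum_norm_sliceAt_sq (e : X × Z ≃ W) (χ : L2 W) :
    HasSum (fun z => ‖sliceAt e z χ‖ ^ 2) (‖χ‖ ^ 2) := by
  have h1 := (((Equiv.prodComm Z X).trans e).hasSum_iff).2 (hasSum_norm_sq χ)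
  exact h1.prod_fiberwise fun z => hasSum_norm_sq (sliceAt e z χ)

/-- A vector is a square-summable family of slices. This produces the image of a vector under an
amplified bounded operator. -/
theorem exists_of_sliceAt (e : X × Z ≃ W) (v : Z → L2 X) (hv : Summable fun z => ‖v z‖ ^ 2) :
    ∃ χ : L2 W, ∀ z, sliceAt e z χ = v z := by
  have h1 : Summable fun q : Z × X => ‖v q.1 q.2‖ ^ 2 := by
    rw [summable_prod_of_nonneg fun _ => by positivity]
    exact ⟨fun z => summable_norm_sq (v z), by simpa only [(hasSum_norm_sq _).tsum_eq] using hv⟩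
  have h2 : Summable fun w => ‖v (e.symm w).2 (e.symm w).1‖ ^ 2 :=
    (((Equiv.prodComm X Z).symm.trans e).symm.summable_iff
      (f := fun q : Z × X => ‖v q.1 q.2‖ ^ 2)).2 h1
  refine ⟨⟨fun w => v (e.symm w).2 (e.symm w).1, memlp_two h2⟩, fun z => ?_⟩
  ext x
  rw [sliceAt_apply]
  change v (e.symm (e (x, z))).2 (e.symm (e (x, z))).1 = v z x
  rw [Equiv.symm_apply_apply]

end Slices

section Glue

variable {s t ι : Type}

theorem glue_of_mem {R : Set t} (x : R → ι) (z : (Rᶜ : Set t) → ι) {j : t} (h : j ∈ R) :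
    glue R x z j = x ⟨j, h⟩ := dif_pos h

theorem glue_of_notMem {R : Set t} (x : R → ι) (z : (Rᶜ : Set t) → ι) {j : t} (h : j ∉ R) :
    glue R x z j = z ⟨j, h⟩ := dif_neg h

/-- Configurations of `t` are pairs of configurations of `R` and of its complement. -/
noncomputable def glueEquiv (R : Set t) : (R → ι) × ((Rᶜ : Set t) → ι) ≃ (t → ι) where
  toFun q := glue R q.1 q.2
  invFun w := (fun j => w j, fun j => w j)
  left_inv q := by
    refine Prod.ext (funext fun j => glue_of_mem _ _ j.2) (funext fun j => glue_of_notMem _ _ j.2)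
  right_inv w := by
    funext j
    by_cases h : j ∈ R
    · exact glue_of_mem _ _ h
    · exact glue_of_notMem _ _ h

/-- Configurations of `t` are pairs of configurations of an embedded set and of its complement. -/
noncomputable def splitEquiv (f : s → t) (hf : Function.Injective f) :
    (s → ι) × (((Set.range f)ᶜ : Set t) → ι) ≃ (t → ι) :=
  (Equiv.prodCongr (Equiv.arrowCongr (Equiv.ofInjective f hf) (Equiv.refl ι)) (Equiv.refl _)).trans
    (glueEquiv (Set.range f))

theorem splitEquiv_apply_apply (f : s → t) (hf : Function.Injective f) (x : s → ι)
    (z : ((Set.range f)ᶜ : Set t) → ι) (i : s) : splitEquiv f hf (x, z) (f i) = x i := by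
  refine (glue_of_mem _ _ (Set.mem_range_self i)).trans ?_
  simp [Equiv.arrowCongr]

/-- A slice does not see the part of the base configuration on the embedded sites. Redundantly
indexed slices thus become the fibres of a genuine product decomposition, over which one can sum. -/
theorem slice_splitEquiv (f : s → t) (hf : Function.Injective f) (x : s → ι)
    (z : ((Set.range f)ᶜ : Set t) → ι) :
    slice f hf (splitEquiv f hf (x, z)) = sliceAt (splitEquiv (ι := ι) f hf) z := by
  refine LinearMap.ext fun ψ => ?_
  ext y
  change ψ (Function.extend f y (splitEquiv f hf (x, z))) = ψ (splitEquiv f hf (y, z))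
  refine congrArg ψ (funext fun j => ?_)
  by_cases hj : ∃ i, f i = j
  · obtain ⟨i, rfl⟩ := hj
    rw [hf.extend_apply, splitEquiv_apply_apply]
  · rw [Function.extend_apply' _ _ _ hj]
    have hj' : j ∉ Set.range f := hj
    exact (glue_of_notMem _ _ hj').trans (glue_of_notMem _ _ hj').symm

end Glue

/-! ### Amplified operators and their expectation values -/

section Amplification

variable {s t u ι : Type}

theorem mem_ampGraph {e : s → t} {he : Function.Injective e} {O : UOp (HSpace s ι)}
    {x y : HSpace t ι} :
    (x, y) ∈ ampGraph e he O ↔ ∀ z, (slice e he z x, slice e he z y) ∈ O.graph := Iff.rfl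

theorem slice_apply {e : s → t} {he : Function.Injective e} (z : t → ι) (x : HSpace t ι)
    (c : s → ι) : slice e he z x c = x (Function.extend e c z) := rfl

theorem extend_comp_extend {f : s → t} {F : t → u} (hf : Function.Injective f)
    (hF : Function.Injective F) (x : s → ι)
    (y : t → ι) (z : u → ι) :
    Function.extend F (Function.extend f x y) z =
      Function.extend (F ∘ f) x (Function.extend F y z) := by
  funext q
  by_cases hq : ∃ j, F j = q
  · obtain ⟨j, rfl⟩ := hq
    rw [hF.extend_apply]
    by_cases hj : ∃ i, f i = j
    · obtain ⟨i, rfl⟩ := hj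
      rw [hf.extend_apply]
      exact ((hF.comp hf).extend_apply x _ i).symm
    · rw [Function.extend_apply' _ _ _ hj, Function.extend_apply', hF.extend_apply]
      rintro ⟨i, hi⟩
      exact hj ⟨i, hF hi⟩
  · rw [Function.extend_apply' _ _ _ hq, Function.extend_apply', Function.extend_apply' _ _ _ hq]
    rintro ⟨i, hi⟩
    exact hq ⟨f i, hi⟩

theorem extend_self (F : t → u) (hF : Function.Injective F) (z : u → ι) :
    Function.extend F (z ∘ F) z = z := by
  funext b
  by_cases hb : ∃ a, F a = b
  · obtain ⟨a, rfl⟩ := hb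
    simp [hF.extend_apply]
  · simp [Function.extend_apply' _ _ _ hb]

theorem slice_slice {f : s → t} {F : t → u} (hf : Function.Injective f)
    (hF : Function.Injective F) (y : t → ι) (z : u → ι) (Ψ : HSpace u ι) :
    slice f hf y (slice F hF z Ψ) = slice (F ∘ f) (hF.comp hf) (Function.extend F y z) Ψ := by
  ext x
  rw [slice_apply, slice_apply, slice_apply, extend_comp_extend hf hF]

/-- Amplification in stages. -/
theorem mem_ampGraph_comp {f : s → t} {F : t → u} (hf : Function.Injective f)
    (hF : Function.Injective F) {O : UOp (HSpace s ι)} {Ψ Ω : HSpace u ι} :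
    (Ψ, Ω) ∈ ampGraph F hF (amp f hf O) ↔ (Ψ, Ω) ∈ ampGraph (F ∘ f) (hF.comp hf) O := by
  simp only [mem_ampGraph, amp_graph, slice_slice]
  constructor
  · intro h z
    have := h z (z ∘ F)
    rwa [extend_self F hF] at this
  · intro h z y
    exact h _

theorem ampGraph_mono {e : s → t} {he : Function.Injective e} {O O' : UOp (HSpace s ι)}
    (h : O ≤ O') : ampGraph e he O ≤ ampGraph e he O' :=
  fun _ hp z => LinearPMap.le_graph_of_le h (hp z)

/-- The expectation value of the amplification of `O` in the state `ψ` is defined, with value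
`a`. -/
def HasExpect (f : s → t) (hf : Function.Injective f) (O : UOp (HSpace s ι)) (ψ : HSpace t ι)
    (a : ℂ) : Prop :=
  ∃ ω, (ψ, ω) ∈ ampGraph f hf O ∧ ⟪ψ, ω⟫_ℂ = a

theorem HasExpect.congr {f g : s → t} {hf : Function.Injective f} {O : UOp (HSpace s ι)}
    {ψ : HSpace t ι} {a : ℂ} (h : HasExpect f hf O ψ a) (hg : Function.Injective g) (hfg : f = g) :
    HasExpect g hg O ψ a := by
  subst hfg
  exact h

/-- Bounded operators have expectation values bounded by their norm. -/
theorem exists_hasExpect_of_bounded {f : s → t} (hf : Function.Injective f)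
    (B : HSpace s ι →L[ℂ] HSpace s ι) (ψ : HSpace t ι) (hψ : ‖ψ‖ = 1) :
    ∃ a, HasExpect f hf ((B : HSpace s ι →ₗ[ℂ] HSpace s ι).toPMap ⊤) ψ a ∧ ‖a‖ ≤ ‖B‖ := by
  let e := splitEquiv (ι := ι) f hf
  have hv : HasSum (fun z => ‖sliceAt e z ψ‖ ^ 2) 1 := by
    simpa [hψ] using hasSum_norm_sliceAt_sq e ψ
  have hB : Summable fun z => ‖B (sliceAt e z ψ)‖ ^ 2 := by
    refine Summable.of_nonneg_of_le (fun _ => by positivity) (fun z => ?_)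
      (hv.summable.mul_left (‖B‖ ^ 2))
    rw [← mul_pow]
    gcongr
    exact B.le_opNorm _
  obtain ⟨Ω, hΩ⟩ := exists_of_sliceAt e _ hB
  have hΩn : ‖Ω‖ ≤ ‖B‖ := by
    have h1 := hasSum_norm_sliceAt_sq e Ω
    simp only [hΩ] at h1
    have h2 := hasSum_le (fun z => ?_) h1 (hv.mul_left (‖B‖ ^ 2))
    · rw [mul_one] at h2
      exact (sq_le_sq₀ (norm_nonneg _) (norm_nonneg _)).1 h2
    · rw [← mul_pow]
      gcongr
      exact B.le_opNorm _
  refine ⟨⟪ψ, Ω⟫_ℂ, ⟨Ω, fun w => ?_, rfl⟩, ?_⟩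
  · obtain ⟨⟨x, z⟩, rfl⟩ := e.surjective w
    rw [slice_splitEquiv, LinearPMap.mem_graph_iff]
    exact ⟨⟨sliceAt e z ψ, trivial⟩, rfl, (hΩ z).symm⟩
  · refine (norm_inner_le_norm ψ Ω).trans ?_
    rwa [hψ, one_mul]

end Amplification

/-! ### Product states of copies of the lattice -/

section Product

variable {M Λ P ι : Type}

/-- The product state of copies of the lattice. -/
noncomputable def copies [Fintype M] (χ : M → HSpace Λ ι) : HSpace (M × Λ) ι :=
  prodVec (Equiv.curry M Λ ι) χ

theorem extend_prodMk [DecidableEq M] {g : P → Λ} (hg : Function.Injective g) (m m' : M) (x : P → ι)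
    (w : M × Λ → ι) :
    (fun j => Function.extend (fun p => (m, g p)) x w (m', j)) =
      if m' = m then Function.extend g x (fun j => w (m, j)) else fun j => w (m', j) := by
  have hmg : Function.Injective fun p => (m, g p) := fun _ _ h => hg (Prod.ext_iff.1 h).2
  funext j
  split_ifs with h
  · subst h
    by_cases hj : ∃ p, g p = j
    · obtain ⟨p, rfl⟩ := hj
      rw [hg.extend_apply]
      exact hmg.extend_apply _ _ p
    · rw [Function.extend_apply' _ _ _ hj, Function.extend_apply']
      rintro ⟨p, hp⟩
      exact hj ⟨p, (Prod.ext_iff.1 hp).2⟩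
  · rw [Function.extend_apply']
    rintro ⟨p, hp⟩
    exact h (Prod.ext_iff.1 hp).1.symm

/-- Slicing within copy m turns the other factors into scalars, and the graph of `O` is a linear
subspace. The factors may differ so that operators on different copies can be applied in succession.
-/
theorem mem_ampGraph_copies [Fintype M] [DecidableEq M] {g : P → Λ} (hg : Function.Injective g) {O : UOp (HSpace P ι)} (m : M)
    (hmg : Function.Injective fun p => (m, g p))
    {χ : M → HSpace Λ ι} {ω : HSpace Λ ι} (h : (χ m, ω) ∈ ampGraph g hg O) :
    (copies χ, copies (Function.update χ m ω)) ∈ ampGraph (fun p => (m, g p)) hmg O := by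
  intro w
  have h1 := O.graph.smul_mem (∏ m' ∈ Finset.univ.erase m, χ m' (fun j => w (m', j)))
    (h fun j => w (m, j))
  have h2 : ∀ ω' : HSpace Λ ι, slice (fun p => (m, g p)) hmg w (copies (Function.update χ m ω')) =
      (∏ m' ∈ Finset.univ.erase m, χ m' (fun j => w (m', j))) • slice g hg (fun j => w (m, j)) ω' := by
    intro ω'
    ext x
    rw [slice_apply, copies, prodVec_apply, lp.coeFn_smul, Pi.smul_apply, slice_apply, smul_eq_mul,
      ← Finset.mul_prod_erase _ _ (Finset.mem_univ m), mul_comm]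
    congr 1
    · refine Finset.prod_congr rfl fun m' hm' => ?_
      have hne := (Finset.mem_erase.1 hm').1
      rw [Function.update_of_ne hne]
      have := extend_prodMk hg m m' x w
      rw [if_neg hne] at this
      exact congrArg (χ m') this
    · rw [Function.update_self]
      have := extend_prodMk hg m m x w
      rw [if_pos rfl] at this
      exact congrArg ω' this
  have h3 := h2 (χ m)
  rw [Function.update_eq_self] at h3
  rw [h2, h3]
  exact h1

theorem inner_copies [Fintype M] (χ χ' : M → HSpace Λ ι) :
    ⟪copies χ, copies χ'⟫_ℂ = ∏ m, ⟪χ m, χ' m⟫_ℂ := inner_prodVec _ _ _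

theorem HasExpect.in_copies [Fintype M] [DecidableEq M] {g : P → Λ} {hg : Function.Injective g} {O : UOp (HSpace P ι)} {a : ℂ}
    {ψ : HSpace Λ ι} (hψ : ‖ψ‖ = 1) (h : HasExpect g hg O ψ a) (m : M)
    (hmg : Function.Injective fun p => (m, g p)) :
    HasExpect (fun p => (m, g p)) hmg O (copies fun _ : M => ψ) a := by
  obtain ⟨ω, h1, h2⟩ := h
  refine ⟨_, mem_ampGraph_copies hg m hmg h1, ?_⟩
  have hψ2 : ⟪ψ, ψ⟫_ℂ = 1 := by rw [inner_self_eq_norm_sq_to_K, hψ]; simp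
  rw [inner_copies, ← Finset.mul_prod_erase _ _ (Finset.mem_univ m), Function.update_self, h2]
  rw [Finset.prod_eq_one, mul_one]
  intro m' hm'
  rw [Function.update_of_ne (Finset.mem_erase.1 hm').1, hψ2]

end Product

/-! ### Translation invariance -/

section Translation

variable {d n : ℕ} {P ι : Type}

/-- Translation of states of the lattice. -/
def shift (v : Lattice d n) : HSpace (Lattice d n) ι →ₗ[ℂ] HSpace (Lattice d n) ι :=
  pull (fun x j => x (j + v)) fun x y h => funext fun j => by
    simpa using congrFun h (j - v)

theorem shift_apply (v : Lattice d n) (ψ : HSpace (Lattice d n) ι) (x : Lattice d n → ι) :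
    shift v ψ x = ψ (fun j => x (j + v)) := rfl

theorem inner_shift (v : Lattice d n) (ψ ψ' : HSpace (Lattice d n) ι) :
    ⟪shift v ψ, shift v ψ'⟫_ℂ = ⟪ψ, ψ'⟫_ℂ := by
  have h := ((Equiv.arrowCongr (Equiv.addRight v).symm (Equiv.refl ι)).hasSum_iff).2
    (hasSum_inner ψ ψ')
  exact (hasSum_inner _ _).unique h

theorem mem_ampGraph_shift {g : P → Lattice d n} (hg : Function.Injective g)
    {O : UOp (HSpace P ι)} (v : Lattice d n) (hgv : Function.Injective fun p => g p + v)
    {ψ ω : HSpace (Lattice d n) ι} (h : (ψ, ω) ∈ ampGraph g hg O) :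
    (shift v ψ, shift v ω) ∈ ampGraph (fun p => g p + v) hgv O := by
  intro z
  have h2 : ∀ χ : HSpace (Lattice d n) ι, slice (fun p => g p + v) hgv z (shift v χ) =
      slice g hg (fun j => z (j + v)) χ := by
    intro χ
    ext x
    rw [slice_apply, shift_apply, slice_apply]
    refine congrArg χ (funext fun j => ?_)
    by_cases hj : ∃ p, g p = j
    · obtain ⟨p, rfl⟩ := hj
      rw [hg.extend_apply]
      exact hgv.extend_apply x z p
    · rw [Function.extend_apply' _ _ _ hj, Function.extend_apply']
      rintro ⟨p, hp⟩
      exact hj ⟨p, add_right_cancel hp⟩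
  rw [h2, h2]
  exact h _

theorem exists_apply_ne_zero {X : Type} {ψ : L2 X} (hψ : ‖ψ‖ = 1) : ∃ x, ψ x ≠ 0 := by
  by_contra! h
  have : ψ = 0 := by ext x; exact h x
  simp [this] at hψ

/-- Invariance of the projector determines the vector up to a phase. The phase is read off at a
configuration where ψ does not vanish. -/
theorem TranslationInvariant.exists_phase {ψ : HSpace (Lattice d n) ι} (hψ : ‖ψ‖ = 1)
    (h : TranslationInvariant ψ) (v : Lattice d n) :
    ∃ c : ℂ, c * star c = 1 ∧ shift v ψ = c • ψ := by
  obtain ⟨y, hy⟩ := exists_apply_ne_zero hψ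
  have h1 := h v y y
  have hy' : star (ψ y) ≠ 0 := star_ne_zero.2 hy
  have hy2 : ψ (fun j => y (j + v)) ≠ 0 := by
    intro h0
    rw [h0, zero_mul] at h1
    exact mul_ne_zero hy hy' h1.symm
  have hy2' : star (ψ (fun j => y (j + v))) ≠ 0 := star_ne_zero.2 hy2
  refine ⟨star (ψ y) / star (ψ (fun j => y (j + v))), ?_, ?_⟩
  · rw [star_div₀, star_star, star_star, div_mul_div_comm, div_eq_one_iff_eq (mul_ne_zero hy2' hy2)]
    rw [mul_comm, ← h1, mul_comm]
  · ext x
    rw [shift_apply, lp.coeFn_smul, Pi.smul_apply, smul_eq_mul, div_mul_eq_mul_div,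
      eq_div_iff hy2', h v x y, mul_comm]

/-- Expectation values in a translation-invariant state are translation-invariant. -/
theorem HasExpect.translate {ψ : HSpace (Lattice d n) ι} (hψ : ‖ψ‖ = 1)
    (hinv : TranslationInvariant ψ) {g : P → Lattice d n} {hg : Function.Injective g}
    {O : UOp (HSpace P ι)} {a : ℂ} (h : HasExpect g hg O ψ a) (v : Lattice d n)
    (hgv : Function.Injective fun p => g p + v) : HasExpect (fun p => g p + v) hgv O ψ a := by
  obtain ⟨ω, h1, h2⟩ := h
  obtain ⟨c, hc, hcψ⟩ := hinv.exists_phase hψ v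
  have h3 := mem_ampGraph_shift hg v hgv h1
  rw [hcψ] at h3
  have h4 := Submodule.smul_mem _ (star c) h3
  have h5 : star c • (c • ψ, shift v ω) = (ψ, star c • shift v ω) := by
    rw [Prod.smul_mk, smul_smul, mul_comm, hc, one_smul]
  rw [h5] at h4
  refine ⟨_, h4, ?_⟩
  have h6 := inner_shift v ψ ω
  rw [hcψ, inner_smul_left] at h6
  rw [inner_smul_right, ← h2, ← h6]
  rfl

end Translation

/-! ### Factorization of expectations across copies -/

section Cut

variable {M Λ A B ι : Type}

/-- An operator acting on no site is a scalar. -/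
theorem HasExpect.of_isEmpty [IsEmpty B] {t : Type} {g : B → Λ} {hg : Function.Injective g}
    {O : UOp (HSpace B ι)} {ψ : HSpace Λ ι} (hψ : ‖ψ‖ = 1) {a : ℂ} (h : HasExpect g hg O ψ a)
    (f : B → t) (hf : Function.Injective f) (Ψ : HSpace t ι) :
    (Ψ, a • Ψ) ∈ ampGraph f hf O := by
  obtain ⟨y, h1, h2⟩ := h
  obtain ⟨z₀, hz₀⟩ := exists_apply_ne_zero hψ
  have hs : ∀ {u : Type} (k : B → u) (hk : Function.Injective k) (z : u → ι) (χ : HSpace u ι)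
      (x : B → ι), slice k hk z χ x = χ z := by
    intro u k hk z χ x
    rw [slice_apply]
    refine congrArg χ (funext fun j => ?_)
    rw [Function.extend_apply']
    rintro ⟨i, _⟩
    exact isEmptyElim i
  have key : ∀ {u : Type} (k : B → u) (hk : Function.Injective k) (χ : HSpace u ι),
      (χ, (y z₀ / ψ z₀) • χ) ∈ ampGraph k hk O := by
    intro u k hk χ z
    have h3 := O.graph.smul_mem (χ z / ψ z₀) (h1 z₀)
    convert h3 using 1
    refine Prod.ext ?_ ?_
    · ext x
      rw [Prod.smul_fst, lp.coeFn_smul, Pi.smul_apply]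
      simp only [hs, smul_eq_mul]
      field_simp
    · ext x
      rw [Prod.smul_snd, lp.coeFn_smul, Pi.smul_apply]
      simp only [hs, smul_eq_mul, lp.coeFn_smul, Pi.smul_apply]
      field_simp
  have hψ2 : ⟪ψ, ψ⟫_ℂ = 1 := by rw [inner_self_eq_norm_sq_to_K, hψ]; simp
  have hy : y = (y z₀ / ψ z₀) • ψ := by
    have e1 : (ψ, y) ∈ (amp g hg O).graph := by rw [amp_graph]; exact h1
    have e2 : (ψ, (y z₀ / ψ z₀) • ψ) ∈ (amp g hg O).graph := by rw [amp_graph]; exact key g hg ψ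
    exact LinearPMap.mem_graph_snd_inj _ e1 e2 rfl
  have ha : a = y z₀ / ψ z₀ := by
    rw [← h2]
    conv_lhs => rw [hy]
    rw [inner_smul_right, hψ2, mul_one]
  rw [ha]
  exact key f hf Ψ

/-- In a product state, expectation values of products of operators on different copies
factorize. -/
theorem exists_mul_of_copies [Fintype M] [DecidableEq M] {ψ : HSpace Λ ι} (hψ : ‖ψ‖ = 1)
    {gA : A → Λ} {hgA : Function.Injective gA} {OA : UOp (HSpace A ι)} {α : ℂ}
    (hA : HasExpect gA hgA OA ψ α) {gB : B → Λ} {hgB : Function.Injective gB}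
    {OB : UOp (HSpace B ι)} {β : ℂ} (hB : HasExpect gB hgB OB ψ β) {m m' : M} (hm : m ≠ m')
    (hmA : Function.Injective fun p => (m, gA p)) (hmB : Function.Injective fun p => (m', gB p)) :
    ∃ Y Ω : HSpace (M × Λ) ι,
      (copies fun _ : M => ψ, Y) ∈ ampGraph (fun p => (m', gB p)) hmB OB ∧
      (Y, Ω) ∈ ampGraph (fun p => (m, gA p)) hmA OA ∧
      ⟪copies fun _ : M => ψ, Ω⟫_ℂ = α * β := by
  obtain ⟨ω, h1, h2⟩ := hA
  obtain ⟨y, h3, h4⟩ := hB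
  refine ⟨_, _, mem_ampGraph_copies hgB m' hmB (χ := fun _ => ψ) h3,
    mem_ampGraph_copies hgA m hmA (ω := ω) ?_, ?_⟩
  · rwa [Function.update_of_ne hm]
  · have hψ2 : ⟪ψ, ψ⟫_ℂ = 1 := by rw [inner_self_eq_norm_sq_to_K, hψ]; simp
    rw [inner_copies, ← Finset.mul_prod_erase _ _ (Finset.mem_univ m), Function.update_self, h2,
      ← Finset.mul_prod_erase _ _ (Finset.mem_erase.2 ⟨hm.symm, Finset.mem_univ m'⟩),
      Function.update_of_ne hm.symm, Function.update_self, h4, Finset.prod_eq_one, mul_one]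
    intro q hq
    have hq1 := (Finset.mem_erase.1 hq)
    have hq2 := (Finset.mem_erase.1 hq1.2)
    rw [Function.update_of_ne hq2.1, Function.update_of_ne hq1.1, hψ2]

end Cut


/-! ### Block decomposition and purification of the product of reduced states -/

section Blocks

variable {Λ M ι : Type} {R : Set Λ}

/-- The embedding of the lattice into copies of the lattice, for a decomposition of the lattice into
blocks. -/
def blockEmb (θ : Λ ≃ M × R) (j : Λ) : M × Λ := ((θ j).1, ((θ j).2 : Λ))

theorem blockEmb_injective (θ : Λ ≃ M × R) : Function.Injective (blockEmb θ) := by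
  intro i j h
  have h1 := Prod.ext_iff.1 h
  exact θ.injective (Prod.ext h1.1 (Subtype.ext h1.2))

/-- Configurations of all copies are pairs of a configuration of the lattice and of configurations
of the complements of the block in every copy. -/
noncomputable def copiesEquiv (θ : Λ ≃ M × R) :
    (Λ → ι) × (M → (Rᶜ : Set Λ) → ι) ≃ (M × Λ → ι) where
  toFun q := fun k => glue R (fun r => q.1 (θ.symm (k.1, r))) (q.2 k.1) k.2
  invFun w := (fun j => w (blockEmb θ j), fun m j => w (m, j))
  left_inv q := by
    refine Prod.ext (funext fun j => ?_) (funext fun m => funext fun j => ?_)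
    · change glue R (fun r => q.1 (θ.symm ((θ j).1, r))) (q.2 (θ j).1) (θ j).2 = q.1 j
      rw [glue_of_mem _ _ (θ j).2.2]
      simp
    · change glue R (fun r => q.1 (θ.symm (m, r))) (q.2 m) j = q.2 m j
      exact glue_of_notMem _ _ j.2
  right_inv w := by
    funext k
    by_cases h : k.2 ∈ R
    · refine (glue_of_mem _ _ h).trans ?_
      simp [blockEmb]
    · exact glue_of_notMem _ _ h

theorem copiesEquiv_apply (θ : Λ ≃ M × R) (x : Λ → ι) (z : M → (Rᶜ : Set Λ) → ι) (k : M × Λ) :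
    copiesEquiv θ (x, z) k = glue R (fun r => x (θ.symm (k.1, r))) (z k.1) k.2 := rfl

theorem sliceAt_copiesEquiv (θ : Λ ≃ M × R) (y : Λ → ι) (z : M → (Rᶜ : Set Λ) → ι) :
    sliceAt (copiesEquiv θ) z =
      slice (blockEmb θ) (blockEmb_injective θ) (copiesEquiv θ (y, z)) := by
  refine LinearMap.ext fun Ψ => ?_
  ext x
  rw [sliceAt_apply, slice_apply]
  refine congrArg Ψ (funext fun k => ?_)
  by_cases hk : ∃ j, blockEmb θ j = k
  · obtain ⟨j, rfl⟩ := hk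
    rw [(blockEmb_injective θ).extend_apply, copiesEquiv_apply]
    refine (glue_of_mem _ _ (θ j).2.2).trans ?_
    simp [blockEmb]
  · have hkR : k.2 ∉ R := fun h => hk ⟨θ.symm (k.1, ⟨k.2, h⟩), by simp [blockEmb]⟩
    rw [Function.extend_apply' _ _ _ hk, copiesEquiv_apply, copiesEquiv_apply,
      glue_of_notMem _ _ hkR, glue_of_notMem _ _ hkR]

/-- An operator on the lattice, transported into the copies by `blockEmb`, acts on each slice as the
original operator. Domain statements for the purification thereby descend to the vectors whose
mixture is the product of reduced states. -/
theorem sliceAt_mem_amp {P : Type} (θ : Λ ≃ M × R) (y : Λ → ι) (z : M → (Rᶜ : Set Λ) → ι)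
    {f : P → Λ} (hf : Function.Injective f) {O : UOp (HSpace P ι)} {Ψ Ω : HSpace (M × Λ) ι}
    (h : (Ψ, Ω) ∈ ampGraph (fun p => blockEmb θ (f p)) ((blockEmb_injective θ).comp hf) O) :
    (sliceAt (copiesEquiv θ) z Ψ, sliceAt (copiesEquiv θ) z Ω) ∈ (amp f hf O).graph := by
  rw [sliceAt_copiesEquiv θ y z]
  exact (mem_ampGraph_comp hf (blockEmb_injective θ)).2 h _

/-- Configurations of the lattice are families of configurations of the block. -/
def blockEquiv (θ : Λ ≃ M × R) : (Λ → ι) ≃ (M → (R → ι)) :=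
  (Equiv.arrowCongr θ (Equiv.refl ι)).trans (Equiv.curry M R ι)

theorem reducedState_eq (ψ : HSpace Λ ι) :
    reducedState ψ R = mixture fun z => sliceAt (glueEquiv R) z ψ := rfl

end Blocks

/-! ### Couplings inside a block and across its boundary -/

section Boundary

variable {d n : ℕ} {M ι : Type} {R : Set (Lattice d n)}

theorem hasExpect_of_mem_graph {Λ P : Type} {f : P → Λ} {hf : Function.Injective f}
    {O : UOp (HSpace P ι)} {ψ ω : HSpace Λ ι} (h : (ψ, ω) ∈ (amp f hf O).graph) :
    HasExpect f hf O ψ ⟪ψ, ω⟫_ℂ := by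
  rw [amp_graph] at h
  exact ⟨ω, h, rfl⟩

theorem ampGraph_congr {Λ P : Type} {f g : P → Λ} {hf : Function.Injective f}
    {hg : Function.Injective g} {O : UOp (HSpace P ι)} (hfg : f = g)
    {q : HSpace Λ ι × HSpace Λ ι} (h : q ∈ ampGraph f hf O) : q ∈ ampGraph g hg O := by
  subst hfg
  exact h

theorem HasExpect.unique {Λ P : Type} {f : P → Λ} {hf : Function.Injective f}
    {O : UOp (HSpace P ι)} {ψ : HSpace Λ ι} {a b : ℂ} (ha : HasExpect f hf O ψ a)
    (hb : HasExpect f hf O ψ b) : a = b := by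
  obtain ⟨x, hx, rfl⟩ := ha
  obtain ⟨y, hy, rfl⟩ := hb
  rw [← amp_graph] at hx hy
  rw [LinearPMap.mem_graph_snd_inj _ hx hy rfl]

variable {s : M → Lattice d n} {θ : Lattice d n ≃ M × R}
  (hθ : ∀ m r, θ.symm (m, r) = s m + (r : Lattice d n))

include hθ in
theorem blockEmb_add (m : M) {r : Lattice d n} (hr : r ∈ R) :
    blockEmb θ (s m + r) = (m, r) := by
  have : θ (s m + r) = (m, ⟨r, hr⟩) := by
    rw [← Equiv.eq_symm_apply, hθ]
  simp [blockEmb, this]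

include hθ in
theorem eq_add_blockEmb (j : Lattice d n) : j = s (blockEmb θ j).1 + (blockEmb θ j).2 := by
  have := hθ (θ j).1 (θ j).2
  rw [Prod.mk.eta, Equiv.symm_apply_apply] at this
  exact this

-- If s m + b lay in block m, its position relative to that block's corner would be b, which is
-- outside R. The two sides of a cut therefore land in different copies.
include hθ in
theorem blockEmb_fst_ne (m : M) {b : Lattice d n} (hb : b ∉ R) :
    m ≠ (blockEmb θ (s m + b)).1 := by
  intro h
  have h1 := eq_add_blockEmb hθ (s m + b)
  rw [← h] at h1
  have h2 : b = (blockEmb θ (s m + b)).2 := add_left_cancel h1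
  exact hb (h2 ▸ (θ (s m + b)).2.2)

/-- Operators acting inside the block have the same expectation values in the product state. -/
theorem HasExpect.in_block [Fintype M] [DecidableEq M] {P : Type} {ψ : HSpace (Lattice d n) ι} (hψ : ‖ψ‖ = 1)
    (hinv : TranslationInvariant ψ) (hθ : ∀ m r, θ.symm (m, r) = s m + (r : Lattice d n))
    {g : P → Lattice d n} {hg : Function.Injective g}
    {O : UOp (HSpace P ι)} {a : ℂ} (h : HasExpect g hg O ψ a) (m : M)
    (hgR : ∀ p, g p - s m ∈ R) :
    HasExpect (fun p => blockEmb θ (g p)) ((blockEmb_injective θ).comp hg) O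
      (copies fun _ : M => ψ) a := by
  have hg' : Function.Injective fun p => g p + (-s m) := fun p q h => hg (add_right_cancel h)
  have hmg : Function.Injective fun p => (m, g p + (-s m)) :=
    fun p q h => hg' (Prod.ext_iff.1 h).2
  refine (HasExpect.in_copies hψ (h.translate hψ hinv (-s m) hg') m hmg).congr _ (funext fun p => ?_)
  rw [← sub_eq_add_neg, ← blockEmb_add hθ m (hgR p), add_sub_cancel]

/-- The coupling across the boundary of a block, for a decomposition of the coupling. -/
theorem CutDecomposition.exists_hasExpect [Fintype M] [DecidableEq M] {ψ : HSpace (Lattice d n) ι} (hψ : ‖ψ‖ = 1)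
    (hinv : TranslationInvariant ψ) (hθ : ∀ m r, θ.symm (m, r) = s m + (r : Lattice d n))
    {K : UOp (HSpace (nbhd (0 : Lattice d n)) ι)} {r : Lattice d n} (D : CutDecomposition K R r)
    (hD : D.Admissible ψ) (m : M) {b : ℂ}
    (hr : Function.Injective fun p : nbhd (0 : Lattice d n) => r + (p : Lattice d n))
    (hb : HasExpect (fun p : nbhd (0 : Lattice d n) => r + (p : Lattice d n)) hr K ψ b)
    (hf : Function.Injective fun p : nbhd (0 : Lattice d n) =>
      blockEmb θ (s m + (r + (p : Lattice d n)))) :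
    ∃ b', HasExpect (fun p : nbhd (0 : Lattice d n) =>
      blockEmb θ (s m + (r + (p : Lattice d n)))) hf K (copies fun _ : M => ψ) b' ∧
      ‖b - b'‖ = D.absCov ψ := by
  have hx : ∀ k, ∃ x, (ψ, x) ∈ (opOn (nbhd r ∩ R) (D.hA k)).graph :=
    fun k => LinearPMap.mem_domain_iff.1 (hD k).2
  have hyw : ∀ k, ∃ y w, (ψ, y) ∈ (opOn (D.suppB k) (D.hB k)).graph ∧
      (y, w) ∈ (opOn (nbhd r ∩ R) (D.hA k)).graph := by
    intro k
    obtain ⟨w, hw⟩ := LinearPMap.mem_domain_iff.1 (hD k).1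
    rw [mulOp_graph] at hw
    obtain ⟨y, h1, h2⟩ := hw
    exact ⟨y, w, h1, h2⟩
  choose x hx using hx
  choose y w hy hw using hyw
  have hcov : ∀ k, covAdj (opOn (nbhd r ∩ R) (D.hA k)) (opOn (D.suppB k) (D.hB k)) ψ =
      ⟪ψ, w k⟫_ℂ - ⟪ψ, x k⟫_ℂ * ⟪ψ, y k⟫_ℂ := fun k => covAdj_eq hψ (hx k) (hy k) (hw k)
  have hsum : (ψ, ∑ k, w k) ∈ (opAt (nbhd 0) K r).graph := by
    refine LinearPMap.le_graph_of_le D.sum_le (mem_graph_sum _ fun k => ?_)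
    rw [mulOp_graph]
    exact ⟨y k, hy k, hw k⟩
  have hbe : b = ⟪ψ, ∑ k, w k⟫_ℂ := hb.unique (hasExpect_of_mem_graph hsum)
  let F : Lattice d n → M × Lattice d n := fun j => blockEmb θ (s m + j)
  have hF : Function.Injective F := fun i j h => add_left_cancel (blockEmb_injective θ h)
  have hΩ : ∀ k, ∃ Ω, (copies fun _ : M => ψ, Ω) ∈
      ampGraph F hF (mulOp (opOn (nbhd r ∩ R) (D.hA k)) (opOn (D.suppB k) (D.hB k))) ∧
      ⟪copies fun _ : M => ψ, Ω⟫_ℂ = ⟪ψ, x k⟫_ℂ * ⟪ψ, y k⟫_ℂ := by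
    intro k
    have hA := hasExpect_of_mem_graph (hx k)
    have hB := hasExpect_of_mem_graph (hy k)
    have hFA : (fun j : (nbhd r ∩ R : Set (Lattice d n)) => (m, (j : Lattice d n))) =
        F ∘ Subtype.val := funext fun j => (blockEmb_add hθ m j.2.2).symm
    have hmA : Function.Injective fun j : (nbhd r ∩ R : Set (Lattice d n)) =>
        (m, (j : Lattice d n)) := fun i j h => Subtype.ext (Prod.ext_iff.1 h).2
    have hgraph : ∃ Y Ω, (copies fun _ : M => ψ, Y) ∈
          ampGraph (F ∘ fun j : D.suppB k => (j : Lattice d n)) (hF.comp Subtype.val_injective)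
            (D.hB k) ∧
        (Y, Ω) ∈ ampGraph (fun j : (nbhd r ∩ R : Set (Lattice d n)) => (m, (j : Lattice d n)))
          hmA (D.hA k) ∧
        ⟪copies fun _ : M => ψ, Ω⟫_ℂ = ⟪ψ, x k⟫_ℂ * ⟪ψ, y k⟫_ℂ := by
      -- With empty support h_B is a scalar. Otherwise its only site belongs to some other block m',
      -- and h_B acts in copy m' after a translation by v. A support of several sites could be
      -- spread over several copies, which is why at most one site is allowed.
      rcases (D.suppB k).eq_empty_or_nonempty with he | ⟨b₀, hb₀⟩
      · have : IsEmpty (D.suppB k) := Set.isEmpty_coe_sort.2 he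
        obtain ⟨Ω, h1, h2⟩ := HasExpect.in_copies hψ hA m hmA
        refine ⟨_, ⟪ψ, y k⟫_ℂ • Ω, hB.of_isEmpty hψ _ _ _, Submodule.smul_mem _ _ h1, ?_⟩
        rw [inner_smul_right, h2, mul_comm]
      · have hb₀R : b₀ ∉ R := (D.suppB_subset k hb₀).2
        set m' := (blockEmb θ (s m + b₀)).1 with hm'
        set v := (blockEmb θ (s m + b₀)).2 - b₀ with hv
        have hgB : Function.Injective fun j : D.suppB k => (j : Lattice d n) + v :=
          fun i j h => Subtype.ext (add_right_cancel h)
        have hmB : Function.Injective fun j : D.suppB k => (m', (j : Lattice d n) + v) :=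
          fun i j h => hgB (Prod.ext_iff.1 h).2
        obtain ⟨Y, Ω, h1, h2, h3⟩ := exists_mul_of_copies hψ hA (hB.translate hψ hinv v hgB)
          (blockEmb_fst_ne hθ m hb₀R) hmA hmB
        refine ⟨Y, Ω, ?_, h2, h3⟩
        refine ampGraph_congr (funext fun j => ?_) h1
        have hj : (j : Lattice d n) = b₀ := D.suppB_single k j.2 hb₀
        change (m', (j : Lattice d n) + v) = blockEmb θ (s m + j)
        rw [hj, hv, add_sub_cancel]
    obtain ⟨Y, Ω, h1, h2, h3⟩ := hgraph
    refine ⟨Ω, fun z => ?_, h3⟩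
    rw [mulOp_graph]
    refine ⟨slice F hF z Y, ?_, ?_⟩
    · exact (mem_ampGraph_comp Subtype.val_injective hF).2 h1 z
    · refine (mem_ampGraph_comp Subtype.val_injective hF).2 ?_ z
      exact ampGraph_congr hFA h2
  choose Ω hΩ hΩe using hΩ
  refine ⟨⟪copies fun _ : M => ψ, ∑ k, Ω k⟫_ℂ, ⟨∑ k, Ω k, ?_, rfl⟩, ?_⟩
  · have h1 : (copies fun _ : M => ψ, ∑ k, Ω k) ∈ ampGraph F hF (opAt (nbhd 0) K r) := by
      refine ampGraph_mono D.sum_le fun z => ?_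
      rw [map_sum]
      exact mem_graph_sum _ fun k => hΩ k z
    exact (mem_ampGraph_comp hr hF).1 h1
  · rw [hbe, inner_sum, inner_sum, ← Finset.sum_sub_distrib, CutDecomposition.absCov]
    simp only [hΩe, hcov]

end Boundary


/-! ### Energy of the product of reduced states -/

section TotalEnergy

variable {d n : ℕ} {M ι κ : Type} {R : Set (Lattice d n)}

theorem add_injective_of_subset {P : Set (Lattice d n)} (i : Lattice d n) :
    Function.Injective fun j : P => i + (j : Lattice d n) :=
  fun _ _ h => Subtype.ext (add_left_cancel h)

theorem blockEmb_add_injective (θ : Lattice d n ≃ M × R) {P : Set (Lattice d n)}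
    (i : Lattice d n) : Function.Injective fun j : P => blockEmb θ (i + (j : Lattice d n)) :=
  (blockEmb_injective θ).comp (add_injective_of_subset i)

/-- The energy of the product of the reduced states, in terms of the expectation values of the
couplings in the product of copies of the state. -/
theorem exists_energy_of_blocks [NeZero n] [Fintype M] [DecidableEq M] {s : M → Lattice d n} {θ : Lattice d n ≃ M × R}
    (hθ : ∀ m r, θ.symm (m, r) = s m + (r : Lattice d n))
    {H₁ : UOp (HSpace ({0} : Set (Lattice d n)) ι)} {K : UOp (HSpace (nbhd (0 : Lattice d n)) ι)}
    {H : UOp (HSpace (Lattice d n) ι)} (hH : IsSelfAdjoint H) (hle : localSum H₁ K ≤ H)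
    (σ : EigenData H κ) (hσ : ∀ k, 0 ≤ σ.energy k)
    {ψ : HSpace (Lattice d n) ι} (hψ : ‖ψ‖ = 1) (hinv : TranslationInvariant ψ)
    (hdom : ψ ∈ (localSum H₁ K).domain) {δ : Lattice d n → ℝ}
    (hK : ∀ i b, HasExpect (fun j : nbhd (0 : Lattice d n) => i + (j : Lattice d n))
      (add_injective_of_subset i) K ψ b →
      ∃ b', HasExpect (fun j : nbhd (0 : Lattice d n) => blockEmb θ (i + (j : Lattice d n)))
        (blockEmb_add_injective θ i) K (copies fun _ : M => ψ) b' ∧ b'.re ≤ b.re + δ i) :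
    ∃ U, HasSum (fun k => σ.energy k * (⟪σ.basis k,
      mixture (fun z : M → (Rᶜ : Set (Lattice d n)) → ι =>
        prodVec (blockEquiv θ) fun m => sliceAt (glueEquiv R) (z m) ψ) (σ.basis k)⟫_ℂ).re) U ∧
      U ≤ (expect H ψ).re + ∑ i, δ i := by
  set Ψ : HSpace (M × Lattice d n) ι := copies fun _ : M => ψ with hΨ
  have hd1 : ∀ i, ∃ x, (ψ, x) ∈ (opAt {0} H₁ i).graph := fun i =>
    LinearPMap.mem_domain_iff.1 (mem_domain_of_sum hdom.1 i (Finset.mem_univ i))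
  have hd2 : ∀ i, ∃ x, (ψ, x) ∈ (opAt (nbhd 0) K i).graph := fun i =>
    LinearPMap.mem_domain_iff.1 (mem_domain_of_sum hdom.2 i (Finset.mem_univ i))
  choose x hx using hd1
  choose y hy using hd2
  have hHψ : (ψ, ∑ i, x i + ∑ i, y i) ∈ H.graph :=
    LinearPMap.le_graph_of_le hle (mem_graph_add (mem_graph_sum _ hx) (mem_graph_sum _ hy))
  have h1 : ∀ i, HasExpect (fun j : ({0} : Set (Lattice d n)) => blockEmb θ (i + (j : Lattice d n)))
      (blockEmb_add_injective θ i) H₁ Ψ ⟪ψ, x i⟫_ℂ := by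
    intro i
    refine HasExpect.in_block hψ hinv hθ (hasExpect_of_mem_graph (hx i)) (blockEmb θ i).1 fun p => ?_
    have hp : (p : Lattice d n) = 0 := p.2
    have hi := eq_add_blockEmb hθ i
    rw [hp, add_zero, sub_eq_of_eq_add' hi]
    exact (θ i).2.2
  have h2 := fun i => hK i _ (hasExpect_of_mem_graph (hy i))
  choose X hX hXe using h1
  choose b hb hble using h2
  choose Y hY hYe using hb
  -- Only some configuration is needed, as a base point for slices.
  obtain ⟨y₀, -⟩ := exists_apply_ne_zero hψ
  set Ω := ∑ i, X i + ∑ i, Y i with hΩ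
  have hgraph : ∀ z, (sliceAt (copiesEquiv θ) z Ψ, sliceAt (copiesEquiv θ) z Ω) ∈ H.graph := by
    intro z
    refine LinearPMap.le_graph_of_le hle ?_
    rw [hΩ, map_add, map_sum, map_sum]
    exact mem_graph_add
      (mem_graph_sum _ fun i => sliceAt_mem_amp θ y₀ z (add_injective_of_subset i) (hX i))
      (mem_graph_sum _ fun i => sliceAt_mem_amp θ y₀ z (add_injective_of_subset i) (hY i))
  have hU := Complex.reCLM.hasSum (hasSum_inner_sliceAt (copiesEquiv θ) Ψ Ω)
  -- The slices of `Ψ` along `copiesEquiv θ` are definitionally the product vectors in the goal.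
  refine ⟨(⟪Ψ, Ω⟫_ℂ).re, hasSum_energy hH σ hσ
    (φ := fun z => sliceAt (copiesEquiv θ) z Ψ)
    (hasSum_norm_sliceAt_sq (copiesEquiv θ) Ψ).summable hgraph hU, ?_⟩
  rw [expect_eq hHψ, hΩ, inner_add_right, inner_add_right, inner_sum, inner_sum, inner_sum,
    inner_sum]
  simp only [hXe, hYe, Complex.add_re, Complex.re_sum]
  rw [← Finset.sum_add_distrib, ← Finset.sum_add_distrib, ← Finset.sum_add_distrib]
  exact Finset.sum_le_sum fun i _ => by linarith [hble i]

end TotalEnergy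

/-! ### Tiling the torus by cubes and counting boundary sites -/

section Cubes

variable {d n l : ℕ} [NeZero n]

/-- The corner of a block of edge length `l`, relative to the corner of the first block. -/
def blockCorner (d n l : ℕ) (m : Fin d → Fin (n / l)) : Lattice d n :=
  fun δ => ((l * (m δ : ℕ) : ℕ) : ZMod n)

theorem mul_add_lt {k t : ℕ} (hl : l ∣ n) (hk : k < n / l) (ht : t < l) : l * k + t < n := by
  obtain ⟨q, rfl⟩ := hl
  rw [Nat.mul_div_cancel_left _ (by omega)] at hk
  calc l * k + t < l * k + l := by omega
    _ = l * (k + 1) := by ring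
    _ ≤ l * q := Nat.mul_le_mul_left _ hk

theorem val_mul_add {k : ℕ} {t : ZMod n} (hl : l ∣ n) (hk : k < n / l) (ht : t.val < l) :
    (((l * k : ℕ) : ZMod n) + t).val = l * k + t.val := by
  have h := mul_add_lt hl hk ht
  have h1 : ((l * k : ℕ) : ZMod n).val = l * k := ZMod.val_natCast_of_lt (by omega)
  rw [ZMod.val_add_of_lt (by rw [h1]; exact h), h1]

/-- Euclidean division by l of each coordinate offset from a. As l divides n, quotient and remainder
recombine without wrapping around modulo n. -/
theorem blockCorner_add_bijective (a : Lattice d n) (hl0 : 0 < l) (hl : l ∣ n) :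
    Function.Bijective fun q : (Fin d → Fin (n / l)) × cube a l =>
      blockCorner d n l q.1 + (q.2 : Lattice d n) := by
  constructor
  · rintro ⟨m, r, hr⟩ ⟨m', r', hr'⟩ h
    have hδ : ∀ δ, m δ = m' δ ∧ r δ = r' δ := by
      intro δ
      have h1 : ((l * (m δ : ℕ) : ℕ) : ZMod n) + r δ = ((l * (m' δ : ℕ) : ℕ) : ZMod n) + r' δ :=
        congrFun h δ
      have h2 : l * (m δ : ℕ) + (r δ - a δ).val = l * (m' δ : ℕ) + (r' δ - a δ).val := by
        rw [← val_mul_add hl (m δ).2 (hr δ), ← val_mul_add hl (m' δ).2 (hr' δ), ← add_sub_assoc,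
          ← add_sub_assoc, h1]
      have h3 : (m δ : ℕ) = m' δ := by
        have e1 := congrArg (· / l) h2
        simpa [Nat.mul_add_div hl0, Nat.div_eq_of_lt (hr δ), Nat.div_eq_of_lt (hr' δ)] using e1
      rw [h3] at h1
      exact ⟨Fin.ext h3, add_left_cancel h1⟩
    have hm : m = m' := funext fun δ => (hδ δ).1
    have hr2 : r = r' := funext fun δ => (hδ δ).2
    subst hm hr2
    rfl
  · intro j
    have hlt : ∀ δ, (j δ - a δ).val / l < n / l := fun δ =>
      Nat.div_lt_div_of_lt_of_dvd hl (ZMod.val_lt _)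
    let m : Fin d → Fin (n / l) := fun δ => ⟨(j δ - a δ).val / l, hlt δ⟩
    refine ⟨(m, ⟨j - blockCorner d n l m, fun δ => ?_⟩), add_sub_cancel _ _⟩
    have h1 : (j - blockCorner d n l m) δ - a δ = (((j δ - a δ).val % l : ℕ) : ZMod n) := by
      have h2 : ((l * ((j δ - a δ).val / l) + (j δ - a δ).val % l : ℕ) : ZMod n) = j δ - a δ := by
        rw [Nat.div_add_mod, ZMod.natCast_zmod_val]
      change j δ - ((l * ((j δ - a δ).val / l) : ℕ) : ZMod n) - a δ = _
      rw [Nat.cast_add] at h2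
      linear_combination -h2
    rw [h1, ZMod.val_natCast]
    exact (Nat.mod_le _ _).trans_lt (Nat.mod_lt _ hl0)

/-- The decomposition of the lattice into blocks. -/
noncomputable def blockDecomp (a : Lattice d n) (hl0 : 0 < l) (hl : l ∣ n) :
    Lattice d n ≃ (Fin d → Fin (n / l)) × cube a l :=
  (Equiv.ofBijective _ (blockCorner_add_bijective a hl0 hl)).symm

theorem blockDecomp_symm (a : Lattice d n) (hl0 : 0 < l) (hl : l ∣ n)
    (m : Fin d → Fin (n / l)) (r : cube a l) :
    (blockDecomp a hl0 hl).symm (m, r) = blockCorner d n l m + (r : Lattice d n) := rfl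

/-- An interior offset can change by one without leaving 0, …, l - 1 or wrapping around. So
couplings centred at interior sites stay within a block and cost no energy. -/
theorem add_mem_cube {a r p : Lattice d n} (hln : l ≤ n) (hr : r ∈ cubeInterior a l)
    (hp : p ∈ nbhd (0 : Lattice d n)) : r + p ∈ cube a l := by
  have hval : ∀ y : ZMod n, 1 ≤ y.val → y.val + 1 < l →
      y.val < l ∧ (y + 1).val < l ∧ (y - 1).val < l := by
    intro y h1 h2
    have : Fact (1 < n) := ⟨by omega⟩
    have hv1 : (1 : ZMod n).val = 1 := ZMod.val_one n
    refine ⟨by omega, ?_, ?_⟩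
    · rw [ZMod.val_add_of_lt (by rw [hv1]; omega), hv1]
      exact h2
    · rw [ZMod.val_sub (by rw [hv1]; exact h1)]
      omega
  intro δ
  obtain ⟨h1, h2⟩ := hr δ
  obtain ⟨e0, e1, e2⟩ := hval _ h1 h2
  rcases hp with rfl | ⟨δ', rfl | rfl⟩
  · simpa using e0
  · by_cases hδ : δ = δ'
    · subst hδ
      simpa [add_sub_right_comm] using e1
    · simpa [Pi.single_eq_of_ne hδ] using e0
  · by_cases hδ : δ = δ'
    · subst hδ
      have : r δ + -1 - a δ = r δ - a δ - 1 := by ring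
      simpa [this] using e2
    · simpa [Pi.single_eq_of_ne hδ] using e0

open Classical in
/-- The boundary layers of all blocks together have at most `2 d n ^ d / l` sites. -/
theorem sum_boundary_le (a : Lattice d n) (hl2 : 2 ≤ l) (hl0 : 0 < l) (hl : l ∣ n) {c : ℝ}
    (hc : 0 ≤ c) :
    ∑ i, (if ((blockDecomp a hl0 hl i).2 : Lattice d n) ∈ cubeBoundary a l then c else 0) ≤
      2 * d * c * ((n : ℝ) ^ d / l) := by
  have hlpos : (0 : ℝ) < l := by exact_mod_cast hl0
  have hln : l ≤ n := Nat.le_of_dvd (NeZero.pos n) hl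
  have h1 : ∑ i, (if ((blockDecomp a hl0 hl i).2 : Lattice d n) ∈ cubeBoundary a l then c else 0) =
      ((n / l) ^ d : ℕ) * ∑ r : cube a l,
        (if (r : Lattice d n) ∈ cubeBoundary a l then c else 0) := by
    rw [(blockDecomp a hl0 hl).sum_comp
      (fun q => if (q.2 : Lattice d n) ∈ cubeBoundary a l then c else 0), Fintype.sum_prod_type]
    change ∑ _m : Fin d → Fin (n / l), ∑ r : cube a l,
      (if (r : Lattice d n) ∈ cubeBoundary a l then c else 0) = _
    rw [Finset.sum_const, Finset.card_univ, Fintype.card_fun, Fintype.card_fin, Fintype.card_fin,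
      nsmul_eq_mul]
  have hcard : (n / l) ^ d * Fintype.card (cube a l) = n ^ d := by
    have := Fintype.card_congr (blockDecomp a hl0 hl)
    simpa [Fintype.card_prod, ZMod.card] using this.symm
  have hnl : n / l * l = n := Nat.div_mul_cancel hl
  have hcardR : Fintype.card (cube a l) = l ^ d := by
    have h2 : (n / l) ^ d * l ^ d = n ^ d := by rw [← mul_pow, hnl]
    have h3 : 0 < (n / l) ^ d := pow_pos (Nat.div_pos hln hl0) d
    exact Nat.eq_of_mul_eq_mul_left h3 (hcard.trans h2.symm)
  have hint : (l - 2) ^ d ≤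
      (Finset.univ.filter fun r : cube a l => ¬ (r : Lattice d n) ∈ cubeBoundary a l).card := by
    have hv : ∀ q : Fin (l - 2), (((q : ℕ) + 1 : ℕ) : ZMod n).val = q + 1 := fun q =>
      ZMod.val_natCast_of_lt (by have := q.2; omega)
    let f : (Fin d → Fin (l - 2)) → cube a l := fun q =>
      ⟨fun δ => a δ + (((q δ : ℕ) + 1 : ℕ) : ZMod n), fun δ => by
        rw [add_sub_cancel_left, hv]
        have := (q δ).2
        omega⟩
    have hf : Function.Injective f := by
      intro q q' h
      funext δ
      have h2 := congrFun (congrArg Subtype.val h) δ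
      have h3 := congrArg ZMod.val (add_left_cancel h2)
      rw [hv, hv] at h3
      exact Fin.ext (by omega)
    have hcardim : (Finset.univ.image f).card = (l - 2) ^ d := by
      rw [Finset.card_image_of_injective _ hf]
      simp
    rw [← hcardim]
    refine Finset.card_le_card fun r hr => ?_
    obtain ⟨q, -, rfl⟩ := Finset.mem_image.1 hr
    refine Finset.mem_filter.2 ⟨Finset.mem_univ _, fun hb => hb.2 fun δ => ?_⟩
    change 1 ≤ (a δ + (((q δ : ℕ) + 1 : ℕ) : ZMod n) - a δ).val ∧
      (a δ + (((q δ : ℕ) + 1 : ℕ) : ZMod n) - a δ).val + 1 < l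
    rw [add_sub_cancel_left, hv]
    have := (q δ).2
    omega
  have hbd : ((Finset.univ.filter fun r : cube a l =>
      (r : Lattice d n) ∈ cubeBoundary a l).card : ℝ) ≤ 2 * d / l * (l : ℝ) ^ d := by
    have h2 := Finset.card_filter_add_card_filter_not (s := (Finset.univ : Finset (cube a l)))
      (fun r : cube a l => (r : Lattice d n) ∈ cubeBoundary a l)
    rw [Finset.card_univ, hcardR] at h2
    have h3 : ((Finset.univ.filter fun r : cube a l =>
      (r : Lattice d n) ∈ cubeBoundary a l).card : ℝ) + ((l : ℝ) - 2) ^ d ≤ (l : ℝ) ^ d := by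
      have : ((l - 2 : ℕ) : ℝ) = (l : ℝ) - 2 := by push_cast [hl2]; ring
      rw [← this]
      exact_mod_cast (by omega)
    have hl2' : (2 : ℝ) ≤ l := by exact_mod_cast hl2
    have h4 : 1 + d * (-2 / (l : ℝ)) ≤ (1 + -2 / (l : ℝ)) ^ d := by
      refine one_add_mul_le_pow ?_ d
      rw [le_div_iff₀ hlpos]
      linarith
    have h5 : ((l : ℝ) - 2) ^ d = (1 + -2 / (l : ℝ)) ^ d * (l : ℝ) ^ d := by
      rw [← mul_pow]
      congr 1
      field_simp
      ring
    have h6 : (1 + d * (-2 / (l : ℝ))) * (l : ℝ) ^ d ≤ ((l : ℝ) - 2) ^ d := by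
      rw [h5]; gcongr
    have h7 : (1 + d * (-2 / (l : ℝ))) * (l : ℝ) ^ d = (l : ℝ) ^ d - 2 * d / l * (l : ℝ) ^ d := by
      field_simp
      ring
    linarith
  rw [h1, Finset.sum_ite, Finset.sum_const_zero, add_zero, Finset.sum_const, nsmul_eq_mul]
  have hnl' : ((n / l : ℕ) : ℝ) * l = n := by exact_mod_cast hnl
  calc (((n / l) ^ d : ℕ) : ℝ) * (((Finset.univ.filter fun r : cube a l =>
        (r : Lattice d n) ∈ cubeBoundary a l).card : ℝ) * c)
      ≤ (((n / l) ^ d : ℕ) : ℝ) * ((2 * d / l * (l : ℝ) ^ d) * c) := by gcongr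
    _ = 2 * d * c * ((((n / l : ℕ) : ℝ) * l) ^ d / l) := by
      push_cast
      rw [mul_pow]
      ring
    _ = _ := by rw [hnl']

end Cubes

/-! ### Assembling the bound -/

section Main

variable {d n l : ℕ} {ι κ : Type}

theorem IsCouplingStrength.nonneg {K : UOp (HSpace (nbhd (0 : Lattice d n)) ι)}
    {ψ : HSpace (Lattice d n) ι} {a : Lattice d n} {h : ℝ} (hh : IsCouplingStrength K ψ a l h) :
    0 ≤ h := by
  rcases hh with ⟨B, -, rfl⟩ | ⟨D, -, rfl⟩
  · exact norm_nonneg B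
  · exact Real.iSup_nonneg fun i => norm_nonneg _

variable [NeZero n]

/-- The coupling of a site to its neighbours in the product of the reduced states. -/
theorem exists_hasExpect_blocks {K : UOp (HSpace (nbhd (0 : Lattice d n)) ι)}
    {ψ : HSpace (Lattice d n) ι} (hψ : ‖ψ‖ = 1) (hinv : TranslationInvariant ψ)
    (a : Lattice d n) (hl0 : 0 < l) (hl : l ∣ n) {h : ℝ}
    (hh : IsCouplingStrength K ψ a l h) (i : Lattice d n) (b : ℂ)
    (hb : HasExpect (fun j : nbhd (0 : Lattice d n) => i + (j : Lattice d n))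
      (add_injective_of_subset i) K ψ b) :
    ∃ b', HasExpect (fun j : nbhd (0 : Lattice d n) =>
        blockEmb (blockDecomp a hl0 hl) (i + (j : Lattice d n)))
        (blockEmb_add_injective _ i) K (copies fun _ : Fin d → Fin (n / l) => ψ) b' ∧
      b'.re ≤ b.re + (open Classical in
        if ((blockDecomp a hl0 hl i).2 : Lattice d n) ∈ cubeBoundary a l then 2 * h else 0) := by
  classical
  have hln : l ≤ n := Nat.le_of_dvd (NeZero.pos n) hl
  have hh0 := hh.nonneg
  set θ := blockDecomp a hl0 hl with hθd
  have hθ := blockDecomp_symm a hl0 hl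
  obtain ⟨m, r, hi⟩ : ∃ (m : Fin d → Fin (n / l)) (r : cube a l), θ i = (m, r) := ⟨_, _, rfl⟩
  have hi2 : i = blockCorner d n l m + (r : Lattice d n) := by
    rw [← hθ m r, ← hi, Equiv.symm_apply_apply]
  split_ifs with hbd
  · rw [hi] at hbd
    rcases hh with ⟨B, rfl, rfl⟩ | ⟨D, hD, rfl⟩
    -- Both expectation values have modulus at most ‖B‖, hence the factor 2 in 2h. The covariance
    -- case needs only h.
    · have hΨ : ‖copies fun _ : Fin d → Fin (n / l) => ψ‖ = 1 := by
        rw [copies, norm_prodVec, hψ, Finset.prod_const_one]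
      obtain ⟨b₁, h1, h2⟩ := exists_hasExpect_of_bounded (add_injective_of_subset i) B ψ hψ
      obtain ⟨b', h3, h4⟩ := exists_hasExpect_of_bounded
        (blockEmb_add_injective (P := nbhd (0 : Lattice d n)) θ i) B _ hΨ
      refine ⟨b', h3, ?_⟩
      rw [hb.unique h1]
      have e1 := Complex.abs_re_le_norm b'
      have e2 := Complex.abs_re_le_norm b₁
      have e3 := le_abs_self b'.re
      have e4 := neg_abs_le b₁.re
      linarith
    -- Decompositions are given only at the boundary sites of the one cube R, so the coupling at i
    -- is first translated to its representative r in R.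
    · have hbr : HasExpect (fun j : nbhd (0 : Lattice d n) =>
          (r : Lattice d n) + (j : Lattice d n)) (add_injective_of_subset (r : Lattice d n)) K ψ b := by
        have hg : Function.Injective fun j : nbhd (0 : Lattice d n) =>
            i + (j : Lattice d n) + -blockCorner d n l m :=
          fun p q e => Subtype.ext (add_left_cancel (add_right_cancel e))
        refine (hb.translate hψ hinv (-blockCorner d n l m) hg).congr _ (funext fun p => ?_)
        rw [hi2]
        abel
      have hinj : Function.Injective fun j : nbhd (0 : Lattice d n) =>
          blockEmb θ (blockCorner d n l m + ((r : Lattice d n) + (j : Lattice d n))) :=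
        (blockEmb_injective θ).comp fun p q e =>
          Subtype.ext (add_left_cancel (add_left_cancel e))
      obtain ⟨b', h1, h2⟩ := (D ⟨r, hbd⟩).exists_hasExpect hψ hinv hθ (hD _) m
        (add_injective_of_subset (r : Lattice d n)) hbr hinj
      refine ⟨b', h1.congr _ (funext fun p => by rw [hi2, add_assoc]), ?_⟩
      have hle : (D ⟨r, hbd⟩).absCov ψ ≤ ⨆ i, (D i).absCov ψ :=
        le_ciSup (f := fun i => (D i).absCov ψ) (Set.finite_range _).bddAbove ⟨r, hbd⟩
      rw [← h2, norm_sub_rev] at hle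
      have e1 := Complex.abs_re_le_norm (b' - b)
      have e3 := le_abs_self (b' - b).re
      rw [Complex.sub_re] at e1 e3
      linarith
  · rw [hi] at hbd
    have hint : (r : Lattice d n) ∈ cubeInterior a l := by
      by_contra hcon
      exact hbd ⟨r.2, hcon⟩
    refine ⟨b, HasExpect.in_block hψ hinv hθ hb m fun p => ?_, by simp⟩
    rw [hi2, add_assoc, add_sub_cancel_left]
    exact add_mem_cube hln hint p.2

/-- The entropy of a cube is bounded by the free energy of the whole system at any temperature. -/
theorem entropy_le_gibbs (hl2 : 2 ≤ l) (hl : l ∣ n)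
    {H₁ : UOp (HSpace ({0} : Set (Lattice d n)) ι)} {K : UOp (HSpace (nbhd (0 : Lattice d n)) ι)}
    {H : UOp (HSpace (Lattice d n) ι)} (hH : IsSelfAdjoint H) (hle : localSum H₁ K ≤ H)
    (σ : EigenData H κ) (hσ : Thermal σ.energy) (h0 : ∃ j, σ.energy j = 0)
    {ψ : HSpace (Lattice d n) ι} (hψ : ‖ψ‖ = 1) (hinv : TranslationInvariant ψ)
    (hdom : ψ ∈ (localSum H₁ K).domain) {C h : ℝ}
    (hen : (expect H ψ).re ≤ C * (n : ℝ) ^ d / l) (a : Lattice d n)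
    (hh : IsCouplingStrength K ψ a l h) {T : ℝ} (hT : 0 < T) :
    entropy (reducedState ψ (cube a l)) ≤ ENNReal.ofReal (((l : ℝ) / n) ^ d *
      (Real.log (partitionFn σ.energy T) + (n : ℝ) ^ d * ((C + 4 * d * h) / l) / T)) := by
  classical
  have hl0 : 0 < l := by omega
  have hln : l ≤ n := Nat.le_of_dvd (NeZero.pos n) hl
  have hh0 := hh.nonneg
  have : Nonempty (Fin (n / l)) := ⟨⟨0, Nat.div_pos hln hl0⟩⟩
  obtain ⟨U, hU, hUle⟩ := exists_energy_of_blocks (blockDecomp_symm a hl0 hl) hH hle σ hσ.nonneg hψ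
    hinv hdom (exists_hasExpect_blocks hψ hinv a hl0 hl hh)
  have hφ : HasSum (fun z => ‖sliceAt (glueEquiv (cube a l)) z ψ‖ ^ 2) 1 := by
    simpa [hψ] using hasSum_norm_sliceAt_sq (glueEquiv (cube a l)) ψ
  have h1 := entropy_le_of_tensorPower (blockEquiv (blockDecomp a hl0 hl)) hφ σ.basis hσ h0 hU hT
  rw [reducedState_eq]
  refine h1.trans (ENNReal.ofReal_le_ofReal ?_)
  have h2 := sum_boundary_le a hl2 hl0 hl (c := 2 * h) (by positivity)
  have h3 : U ≤ (n : ℝ) ^ d * ((C + 4 * d * h) / l) := by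
    have : C * (n : ℝ) ^ d / l + 2 * d * (2 * h) * ((n : ℝ) ^ d / l) =
      (n : ℝ) ^ d * ((C + 4 * d * h) / l) := by ring
    linarith
  have hlpos : (0 : ℝ) < l := by exact_mod_cast hl0
  have hnpos : (0 : ℝ) < n := by exact_mod_cast NeZero.pos n
  have hcard : (Fintype.card (Fin d → Fin (n / l)) : ℝ) = ((n : ℝ) / l) ^ d := by
    rw [Fintype.card_fun, Fintype.card_fin, Fintype.card_fin, Nat.cast_pow,
      Nat.cast_div hl hlpos.ne']
  rw [hcard, div_eq_mul_inv, ← inv_pow, inv_div, mul_comm]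
  gcongr

end Main

end AreaLaw

theorem proposition1 (d : ℕ) (hd : 1 ≤ d) (C γ k Δ h : ℝ) (hC : 1 ≤ C) (hγ : 0 < γ) (hk : 0 < k)
    (hΔ : 0 < Δ) :
    ∃ C₀ : ℝ, ∀ (n l : ℕ) [NeZero n], 2 ≤ l → l ∣ n →
      ∀ (ι : Type)
        -- the on-site term and the nearest-neighbour term of the Hamiltonian
        (H₁ : UOp (HSpace ({0} : Set (Lattice d n)) ι))
        (K : UOp (HSpace (nbhd (0 : Lattice d n)) ι)),
        H₁.IsClosed → K.IsClosed →
      -- the Hamiltonian, with ground state energy zero and thermal states at all temperatures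
      ∀ H : UOp (HSpace (Lattice d n) ι), IsSelfAdjoint H → localSum H₁ K ≤ H →
      ∀ (κ : Type) (σ : EigenData H κ),
        (∀ j, 0 ≤ σ.energy j) → (∃ j, σ.energy j = 0) →
        (∀ T : ℝ, 0 < T → Summable fun j => Real.exp (-σ.energy j / T)) →
      -- the translation-invariant pure state of low energy
      ∀ ψ : HSpace (Lattice d n) ι, ‖ψ‖ = 1 → TranslationInvariant ψ →
        ψ ∈ (localSum H₁ K).domain →
        (expect H ψ).re ≤ C * (n : ℝ) ^ d / l →
      -- the cube and the coupling strength
      ∀ a : Lattice d n, IsCouplingStrength K ψ a l h →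
      ∀ T_c : ℝ, 0 < T_c →
        energyDensity σ.energy ((n : ℝ) ^ d) T_c = (C + 4 * d * h) / l →
        ((∀ T : ℝ, 0 < T → T ≤ T_c →
            specificHeat σ.energy ((n : ℝ) ^ d) T ≤ k * (Δ / T) ^ γ * Real.exp (-Δ / T)) →
          entropy (reducedState ψ (cube a l)) ≤
            ENNReal.ofReal (((l : ℝ) / n) ^ d * Real.log (groundDegeneracy σ.energy) +
              C₀ * (l : ℝ) ^ ((d : ℝ) - 1) * Real.log l)) ∧
        ((∀ T : ℝ, 0 < T → T ≤ T_c →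
            specificHeat σ.energy ((n : ℝ) ^ d) T ≤ k * (T / Δ) ^ γ) →
          entropy (reducedState ψ (cube a l)) ≤
            ENNReal.ofReal (((l : ℝ) / n) ^ d * Real.log (groundDegeneracy σ.energy) +
              C₀ * (l : ℝ) ^ ((d : ℝ) - 1 + 1 / (γ + 1)))) := by
  -- The constant must be produced before h is known to be a coupling strength. A negative h never
  -- is one, so any constant serves there.
  by_cases hh0 : 0 ≤ h
  swap
  · refine ⟨0, ?_⟩
    intro n l _ _ _ ι H₁ K _ _ H _ _ κ σ _ _ _ ψ _ _ _ _ a hh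
    exact absurd hh.nonneg hh0
  have ha : 0 < C + 4 * d * h := by positivity
  obtain ⟨C₁, hC₁, hexp⟩ := exists_gibbs_bound_of_exp (γ := γ) hk hΔ ha.le
  obtain ⟨C₂, hC₂, hpow⟩ := exists_gibbs_bound_of_rpow hγ hk hΔ ha
  -- One constant has to serve both decay regimes.
  refine ⟨max C₁ C₂, ?_⟩
  intro n l _ hl2 hl ι H₁ K _ _ H hH hle κ σ hσ h0 hsum ψ hψ hinv hdom hen a hh T_c hTc hu
  have hth : Thermal σ.energy := ⟨hσ, hsum⟩
  have hl2' : (2 : ℝ) ≤ l := by exact_mod_cast hl2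
  have hlpos : (0 : ℝ) < l := by linarith
  have hnpos : (0 : ℝ) < n := by exact_mod_cast NeZero.pos n
  have hN : (0 : ℝ) < (n : ℝ) ^ d := by positivity
  have hU : meanEnergy σ.energy T_c = (n : ℝ) ^ d * ((C + 4 * d * h) / l) := by
    rw [Thermal.energyDensity_eq, div_eq_iff hN.ne'] at hu
    rw [hu, mul_comm]
  have hlog : 0 ≤ Real.log l := Real.log_nonneg (by linarith)
  have hfinal : ∀ {X Y T : ℝ}, 0 < T →
      Real.log (partitionFn σ.energy T) + (n : ℝ) ^ d * ((C + 4 * d * h) / l) / T ≤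
        Real.log (groundDegeneracy σ.energy) + (n : ℝ) ^ d * X → (l : ℝ) ^ d * X ≤ Y →
      entropy (reducedState ψ (cube a l)) ≤
        ENNReal.ofReal (((l : ℝ) / n) ^ d * Real.log (groundDegeneracy σ.energy) + Y) := by
    intro X Y T hT hX hY
    refine (entropy_le_gibbs hl2 hl hH hle σ hth h0 hψ hinv hdom hen a hh hT).trans
      (ENNReal.ofReal_le_ofReal ?_)
    calc ((l : ℝ) / n) ^ d * (Real.log (partitionFn σ.energy T) +
          (n : ℝ) ^ d * ((C + 4 * d * h) / l) / T)
        ≤ ((l : ℝ) / n) ^ d * (Real.log (groundDegeneracy σ.energy) + (n : ℝ) ^ d * X) := by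
          gcongr
      _ = ((l : ℝ) / n) ^ d * Real.log (groundDegeneracy σ.energy) +
          ((l : ℝ) / n * n) ^ d * X := by rw [mul_pow]; ring
      _ ≤ _ := by
        rw [div_mul_cancel₀ _ hnpos.ne']
        gcongr
  constructor
  · intro hc
    obtain ⟨T, hT, hX⟩ := hexp hth h0 hN hl2' hTc hU hc
    refine hfinal hT hX ?_
    rw [Real.rpow_sub_one hlpos.ne', Real.rpow_natCast]
    calc (l : ℝ) ^ d * (C₁ * (Real.log l / l)) = C₁ * ((l : ℝ) ^ d / l) * Real.log l := by ring
      _ ≤ _ := by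
        gcongr
        exact le_max_left _ _
  · intro hc
    obtain ⟨T, hT, hX⟩ := hpow hth h0 hN hl2' hTc hU hc
    refine hfinal hT hX ?_
    have e : (l : ℝ) ^ ((d : ℝ) - 1 + 1 / (γ + 1)) =
        (l : ℝ) ^ d * (l : ℝ) ^ (1 / (γ + 1) - 1) := by
      rw [← Real.rpow_natCast, ← Real.rpow_add hlpos]
      congr 1
      ring
    rw [e, mul_left_comm]
    gcongr
    exact le_max_right _ _
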